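/- An instance $\psi$ of 3-Partitioned-3-SAT is a finite set of clauses, each a disjunction of at most three literals, over a set of $N = 3n$ variables that is partitioned into three disjoint sets $X^\alpha, X^\beta, X^\gamma$ of size $n$ each, such that no clause contains two distinct variables from the same part; the question is whether $\psi$ is satisfiable. An instance $(G,k)$ of Geodetic Set is a finite simple graph $G$ together with a positive integer $k$; the question is whether there is a set $S \subseteq V(G)$ with $|S| \le k$ such that every vertex of $G$ lies on a shortest path between two (not necessarily distinct) vertices of $S$. Let $\mathrm{vc}(G)$ be the minimum size of a vertex cover of $G$. **Theorem.** There is an algorithm that, given an instance $\psi$ of 3-Partitioned-3-SAT, constructs an instance $(G,k)$ of Geodetic Set such that $\psi$ is satisfiable if and only if $(G,k)$ is a Yes-instance. Moreover, if $N = 3n \ge 1$ is the number of variables of $\psi$, then the algorithm runs in time $2^{O(\sqrt N)}$, and $k = 10\lceil \sqrt n\,\rceil$, $\mathrm{vc}(G) + k = O(\sqrt N)$ and $|V(G)| = 2^{O(\sqrt N)}$, with absolute constants in the $O$-terms. (The algorithm is a deterministic random access machine with addition, subtraction and indirect addressing at unit cost; it reads a list of the clauses of $\psi$, and outputs $k$,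 $|V(G)|$ and the adjacency matrix of $G$.) -/

import Mathlib

/-! ### The machine model: a random access machine with a step count

A structured form of the usual unit-cost RAM with addition and (truncated) subtraction as its only
arithmetic, direct registers, indirectly addressed memory and an append-only output tape. There is
no multiplication, so this model and Turing machines simulate each other with polynomial overhead. -/

namespace RAM

/-- Expressions: a literal, the content of a register, sum, truncated difference, and the content
of cell `e` of memory bank `a`. -/
inductive Exp : Type
  | lit (c : ℕ) : Exp
  | var (x : ℕ) : Exp
  | add (e₁ e₂ : Exp) : Exp
  | sub (e₁ e₂ : Exp) : Exp
  | get (a : ℕ) (e : Exp) : Exp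

/-- Programs. Each program is a finite term, hence mentions finitely many registers and banks. -/
inductive Com : Type
  | skip : Com
  | assign (x : ℕ) (e : Exp) : Com
  | store (a : ℕ) (i e : Exp) : Com
  | print (e : Exp) : Com
  | seq (P Q : Com) : Com
  | ite (e : Exp) (P Q : Com) : Com
  | loop (e : Exp) (P : Com) : Com

/-- Machine states: registers, memory banks, and the output word printed so far. -/
structure Store : Type where
  reg : ℕ → ℕ
  mem : ℕ → ℕ → ℕ
  out : List ℕ

/-- The value of an expression. -/
def Exp.eval (σ : Store) : Exp → ℕ
  | .lit c => c
  | .var x => σ.reg x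
  | .add e₁ e₂ => e₁.eval σ + e₂.eval σ
  | .sub e₁ e₂ => e₁.eval σ - e₂.eval σ
  | .get a e => σ.mem a (e.eval σ)

/-- The number of elementary operations needed to evaluate an expression. -/
def Exp.cost : Exp → ℕ
  | .lit _ => 1
  | .var _ => 1
  | .add e₁ e₂ => e₁.cost + e₂.cost + 1
  | .sub e₁ e₂ => e₁.cost + e₂.cost + 1
  | .get _ e => e.cost + 1

/-- `Exec P σ t τ`: the program `P`, started in state `σ`, halts after exactly `t` steps in
state `τ`. The rules are deterministic. A test succeeds when its value is nonzero. -/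
inductive Exec : Com → Store → ℕ → Store → Prop
  | skip (σ : Store) : Exec .skip σ 1 σ
  | assign (x : ℕ) (e : Exp) (σ : Store) :
      Exec (.assign x e) σ (e.cost + 1) { σ with reg := Function.update σ.reg x (e.eval σ) }
  | store (a : ℕ) (i e : Exp) (σ : Store) :
      Exec (.store a i e) σ (i.cost + e.cost + 1)
        { σ with mem := Function.update σ.mem a
                          (Function.update (σ.mem a) (i.eval σ) (e.eval σ)) }
  | print (e : Exp) (σ : Store) :
      Exec (.print e) σ (e.cost + 1) { σ with out := σ.out ++ [e.eval σ] }
  | seq {P Q : Com} {σ τ ρ : Store} {s t : ℕ} :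
      Exec P σ s τ → Exec Q τ t ρ → Exec (.seq P Q) σ (s + t) ρ
  | ite_true {e : Exp} {P Q : Com} {σ τ : Store} {t : ℕ} :
      e.eval σ ≠ 0 → Exec P σ t τ → Exec (.ite e P Q) σ (e.cost + 1 + t) τ
  | ite_false {e : Exp} {P Q : Com} {σ τ : Store} {t : ℕ} :
      e.eval σ = 0 → Exec Q σ t τ → Exec (.ite e P Q) σ (e.cost + 1 + t) τ
  | loop_true {e : Exp} {P : Com} {σ τ ρ : Store} {s t : ℕ} :
      e.eval σ ≠ 0 → Exec P σ s τ → Exec (.loop e P) τ t ρ →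
      Exec (.loop e P) σ (e.cost + 1 + s + t) ρ
  | loop_false {e : Exp} {P : Com} {σ : Store} :
      e.eval σ = 0 → Exec (.loop e P) σ (e.cost + 1) σ

/-- The initial state on an input word `w`: its length is in register `0`, its letters are in the
first cells of bank `0`, everything else is zero, and nothing has been printed. -/
def initial (w : List ℕ) : Store where
  reg := Function.update (fun _ => 0) 0 w.length
  mem := Function.update (fun _ _ => 0) 0 (fun i => w.getD i 0)
  out := []

/-- On the input word `w`, the program `P` halts after exactly `t` steps with output `v`. -/
def RunsTo (P : Com) (w : List ℕ) (t : ℕ) (v : List ℕ) : Prop :=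
  ∃ σ : Store, Exec P (initial w) t σ ∧ σ.out = v

end RAM

/-! ### 3-Partitioned-3-SAT -/

/-- A literal over the variables `x^δ_i`, where `δ : Fin 3` names one of the three parts, each
consisting of `n` variables. `sign = true` is the positive literal. -/
structure PartLiteral (n : ℕ) : Type where
  part : Fin 3
  idx : Fin n
  sign : Bool

/-- An instance of 3-Partitioned-3-SAT: a set of clauses (a duplicate-free list), each a
disjunction of at most three literals, over three disjoint sets of `n` variables each, such that
no clause contains two distinct variables of the same part. -/
structure Partitioned3SAT : Type where
  n : ℕ
  clauses : List (List (PartLiteral n))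
  nodup : clauses.Nodup
  length_le : ∀ C ∈ clauses, C.length ≤ 3
  partitioned : ∀ C ∈ clauses, ∀ l ∈ C, ∀ l' ∈ C, l.part = l'.part → l.idx = l'.idx

namespace Partitioned3SAT

/-- The number `N` of variables. -/
def numVars (ψ : Partitioned3SAT) : ℕ := 3 * ψ.n

/-- Some truth assignment makes at least one literal of every clause true. -/
def Satisfiable (ψ : Partitioned3SAT) : Prop :=
  ∃ τ : Fin 3 → Fin ψ.n → Bool, ∀ C ∈ ψ.clauses, ∃ l ∈ C, τ l.part l.idx = l.sign

/-- The input word: `n`, the number of clauses, and then clause by clause its number of literals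
followed by its literals, a literal being given by its part, its index in the part and its sign. -/
def encode (ψ : Partitioned3SAT) : List ℕ :=
  ψ.n :: ψ.clauses.length ::
    ψ.clauses.flatMap fun C =>
      C.length :: C.flatMap fun l => [(l.part : ℕ), (l.idx : ℕ), if l.sign then 1 else 0]

end Partitioned3SAT

/-! ### Geodetic Set -/

/-- `u` lies on a shortest path from `s` to `t`. -/
def SimpleGraph.OnShortestPath {V : Type*} (G : SimpleGraph V) (s t u : V) : Prop :=
  ∃ p : G.Walk s t, p.IsPath ∧ p.length = G.dist s t ∧ u ∈ p.support

/-- Every vertex lies on a shortest path between two vertices of `S`. -/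
def SimpleGraph.IsGeodeticSet {V : Type*} (G : SimpleGraph V) (S : Set V) : Prop :=
  ∀ u : V, ∃ s₁ ∈ S, ∃ s₂ ∈ S, G.OnShortestPath s₁ s₂ u

/-- An instance `(G, k)` of Geodetic Set: a finite simple graph and a positive integer. -/
structure GeodeticSetInstance : Type where
  order : ℕ
  graph : SimpleGraph (Fin order)
  k : ℕ
  k_pos : 0 < k

namespace GeodeticSetInstance

/-- `(G, k)` is a Yes-instance: `G` has a geodetic set of at most `k` vertices. -/
def IsYes (I : GeodeticSetInstance) : Prop :=
  ∃ S : Finset (Fin I.order), S.card ≤ I.k ∧ I.graph.IsGeodeticSet (S : Set (Fin I.order))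

/-- The vertex cover number of the graph. -/
noncomputable def vc (I : GeodeticSetInstance) : ℕ := I.graph.vertexCoverNum.toNat

open Classical in
/-- The output word: `k`, the number of vertices, and the adjacency matrix row by row. -/
noncomputable def encode (I : GeodeticSetInstance) : List ℕ :=
  I.k :: I.order ::
    (List.finRange I.order).flatMap fun i =>
      (List.finRange I.order).map fun j => if I.graph.Adj i j then 1 else 0

end GeodeticSetInstance

/-! Put s = ⌈√n⌉ and cut each part into s blocks of at most s variables. A block has at most 2^s
assignments, so the graph can afford a vertex `a b f` for every assignment f of every block b and a
vertex `c C` for every clause. All remaining vertices number 25s+2, and they meet every edge, which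
bounds the vertex cover number. In particular there are only 6s value vertices `t j`, one for each
part, position inside a block and truth value, shared by the s blocks of a part. Sharing is
harmless: a clause has at most one variable in each part, so a block and a value of the same part
that occur in the clause belong to the same variable.

The leaves `q`, `p i`, `b b` lie in every geodetic set. Covering `g b` requires in addition one of
the vertices `a b f`, `r b`, `g b` for each block (`exists_local_mem`). Since 1 + (4s-1) + 3s + 3s =
10s = k, a geodetic set within the budget has nothing else, so it selects at most one assignment per
block (`exists_choice`). Any two such vertices are too close together for a shortest path through a
clause, except `a b f` and `b b` of the same block (`close_or_eq`). These have distance 4, through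
`r b` and `g b`, and a path of length 4 through `c C` must be a–t–c–v–b. It exists exactly when f
takes a value occurring in C and b is a block of C (`satisfied_of_covered`). Conversely, a
satisfying choice covers the clauses in this way, and fixed families of paths cover all other
vertices (`isGeodeticSet_of_choice`). `satisfiable_iff` translates choices of block assignments into
truth assignments.

The program writes the adjacency matrix to memory edge by edge and prints it. Each of its loops
makes at most |V| rounds, so its running time is at most a polynomial in |V| that depends on the
program text alone (`Com.bound_le_poly`). Finally |V| ≤ 2^(15s), because there are only polynomially
many distinct clauses (`graphOrder_le`). The concrete matrix and the abstract graph are matched by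
`adj_iff_mem_links`. -/

namespace RAM

/-! ### Time bounds by syntax and total correctness -/

/-- A bound on the running time if every loop runs through at most `M` rounds. -/
def Com.bound (M : ℕ) : Com → ℕ
  | .skip => 1
  | .assign _ e => e.cost + 1
  | .store _ i e => i.cost + e.cost + 1
  | .print e => e.cost + 1
  | .seq P Q => P.bound M + Q.bound M
  | .ite e P Q => e.cost + 1 + P.bound M + Q.bound M
  | .loop e P => M * (e.cost + 1 + P.bound M) + e.cost + 1

/-- Functions of polynomial growth are closed under sums and under multiplication by M. The exponent
is far from optimal, but K and d depend only on the program and disappear in the constant of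
2^O(√N). -/
theorem Com.bound_le_poly (P : Com) : ∃ K d : ℕ, ∀ M, 1 ≤ M → P.bound M ≤ K * M ^ d := by
  have const (c : ℕ) : ∃ K d : ℕ, ∀ M, 1 ≤ M → c ≤ K * M ^ d := ⟨c, 0, by simp⟩
  have add {f g : ℕ → ℕ} (hf : ∃ K d : ℕ, ∀ M, 1 ≤ M → f M ≤ K * M ^ d)
      (hg : ∃ K d : ℕ, ∀ M, 1 ≤ M → g M ≤ K * M ^ d) :
      ∃ K d : ℕ, ∀ M, 1 ≤ M → f M + g M ≤ K * M ^ d := by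
    obtain ⟨K, d, h⟩ := hf
    obtain ⟨K', d', h'⟩ := hg
    refine ⟨K + K', d + d', fun M hM => ?_⟩
    have h1 : M ^ d ≤ M ^ (d + d') := Nat.pow_le_pow_right hM (by omega)
    have h2 : M ^ d' ≤ M ^ (d + d') := Nat.pow_le_pow_right hM (by omega)
    calc f M + g M ≤ K * M ^ d + K' * M ^ d' := add_le_add (h M hM) (h' M hM)
      _ ≤ K * M ^ (d + d') + K' * M ^ (d + d') := by gcongr
      _ = _ := by ring
  have mul {f : ℕ → ℕ} (hf : ∃ K d : ℕ, ∀ M, 1 ≤ M → f M ≤ K * M ^ d) :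
      ∃ K d : ℕ, ∀ M, 1 ≤ M → M * f M ≤ K * M ^ d := by
    obtain ⟨K, d, h⟩ := hf
    refine ⟨K, d + 1, fun M hM => ?_⟩
    calc M * f M ≤ M * (K * M ^ d) := by gcongr; exact h M hM
      _ = _ := by ring
  induction P with
  | skip => exact const 1
  | assign x e => exact const _
  | store a i e => exact const _
  | print e => exact const _
  | seq P Q hP hQ => exact add hP hQ
  | ite e P Q hP hQ => exact add (add (const _) hP) hQ
  | loop e P hP => exact add (add (mul (add (const _) hP)) (const _)) (const _)

/-- Started in `σ`, the program `P` halts within its syntactic time bound, in a state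
satisfying `Q`. -/
def Ends (M : ℕ) (P : Com) (σ : Store) (Q : Store → Prop) : Prop :=
  ∃ t τ, Exec P σ t τ ∧ t ≤ P.bound M ∧ Q τ

/-- Register update. -/
def Store.set (σ : Store) (x v : ℕ) : Store := { σ with reg := Function.update σ.reg x v }

@[simp] theorem Store.set_reg (σ : Store) (x v y : ℕ) :
    (σ.set x v).reg y = if y = x then v else σ.reg y := by
  simp [Store.set, Function.update_apply]

@[simp] theorem Store.set_mem (σ : Store) (x v : ℕ) : (σ.set x v).mem = σ.mem := rfl

@[simp] theorem Store.set_out (σ : Store) (x v : ℕ) : (σ.set x v).out = σ.out := rfl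

/-- Memory update. -/
def Store.put (σ : Store) (a i v : ℕ) : Store :=
  { σ with mem := Function.update σ.mem a (Function.update (σ.mem a) i v) }

@[simp] theorem Store.put_reg (σ : Store) (a i v : ℕ) : (σ.put a i v).reg = σ.reg := rfl

@[simp] theorem Store.put_mem (σ : Store) (a i v b j : ℕ) :
    (σ.put a i v).mem b j = if b = a ∧ j = i then v else σ.mem b j := by
  by_cases h : b = a
  · subst h; simp [Store.put, Function.update_apply]
  · simp [Store.put, h]

@[simp] theorem Store.put_out (σ : Store) (a i v : ℕ) : (σ.put a i v).out = σ.out := rfl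

/-! ### Proof rules for total correctness with a time bound -/

section Rules

variable {M : ℕ} {P P' : Com} {σ : Store} {Q R : Store → Prop}

theorem Ends.mono (h : Ends M P σ Q) (hQ : ∀ τ, Q τ → R τ) : Ends M P σ R :=
  let ⟨t, τ, h1, h2, h3⟩ := h
  ⟨t, τ, h1, h2, hQ τ h3⟩

theorem Ends.skip (h : Q σ) : Ends M .skip σ Q := ⟨1, σ, .skip σ, le_rfl, h⟩

theorem Ends.assign {x : ℕ} {e : Exp} (h : Q (σ.set x (e.eval σ))) : Ends M (.assign x e) σ Q :=
  ⟨_, _, .assign x e σ, le_rfl, h⟩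

theorem Ends.store {a : ℕ} {i e : Exp} (h : Q (σ.put a (i.eval σ) (e.eval σ))) :
    Ends M (.store a i e) σ Q :=
  ⟨_, _, .store a i e σ, le_rfl, h⟩

theorem Ends.print {e : Exp} (h : Q { σ with out := σ.out ++ [e.eval σ] }) :
    Ends M (.print e) σ Q :=
  ⟨_, _, .print e σ, le_rfl, h⟩

theorem Ends.seq (h : Ends M P σ fun τ => Ends M P' τ Q) : Ends M (.seq P P') σ Q := by
  obtain ⟨t, τ, h1, h2, t', τ', h1', h2', h3⟩ := h
  exact ⟨_, _, .seq h1 h1', add_le_add h2 h2', h3⟩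

theorem Ends.ite {e : Exp} (h1 : e.eval σ ≠ 0 → Ends M P σ Q) (h2 : e.eval σ = 0 → Ends M P' σ Q) :
    Ends M (.ite e P P') σ Q := by
  by_cases h : e.eval σ = 0
  · obtain ⟨t, τ, h1, h2, h3⟩ := h2 h
    exact ⟨_, _, .ite_false h h1, by simp only [Com.bound]; omega, h3⟩
  · obtain ⟨t, τ, h1, h2, h3⟩ := h1 h
    exact ⟨_, _, .ite_true h h1, by simp only [Com.bound]; omega, h3⟩

/-- `for x in 0, …, c - 1 do P`. -/
def Com.count (x : ℕ) (c : Exp) (P : Com) : Com :=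
  .seq (.assign x (.lit 0))
    (.loop (.sub c (.var x)) (.seq P (.assign x (.add (.var x) (.lit 1)))))

/-- `I i` describes the state at the head of round i. The loop test evaluates the limit `c` anew
each time, hence `hx` asks the invariant to fix its value. The hypothesis `hn` is where the
syntactic time bound is paid for. -/
theorem Ends.count {x : ℕ} {c : Exp} {n : ℕ} (I : ℕ → Store → Prop) (hn : n ≤ M)
    (h0 : I 0 (σ.set x 0)) (hx : ∀ i τ, I i τ → c.eval τ = n ∧ τ.reg x = i)
    (hP : ∀ i < n, ∀ τ, I i τ → Ends M P τ fun ρ => ρ.reg x = i ∧ I (i + 1) (ρ.set x (i + 1)))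
    (hQ : ∀ τ, I n τ → Q τ) : Ends M (.count x c P) σ Q := by
  refine Ends.seq (Ends.assign ?_)
  -- Induction on the number j of rounds still to come, since `Exec` unfolds a loop from its first
  -- round.
  have key : ∀ j ≤ n, ∀ τ, I (n - j) τ → ∃ t ρ,
      Exec (.loop (.sub c (.var x)) (.seq P (.assign x (.add (.var x) (.lit 1))))) τ t ρ ∧
      t ≤ j * ((Exp.sub c (.var x)).cost + 1 +
        Com.bound M (.seq P (.assign x (.add (.var x) (.lit 1))))) +
          (Exp.sub c (.var x)).cost + 1 ∧ Q ρ := by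
    intro j
    induction j with
    | zero =>
      intro _ τ hτ
      obtain ⟨h1, h2⟩ := hx _ _ hτ
      refine ⟨_, τ, .loop_false (by simp [Exp.eval, h1, h2]), by omega, hQ τ hτ⟩
    | succ j ih =>
      intro hj τ hτ
      obtain ⟨h1, h2⟩ := hx _ _ hτ
      obtain ⟨t, ρ, e1, e2, e3, e4⟩ := hP _ (by omega) τ hτ
      have e5 := Exec.assign x (.add (.var x) (.lit 1)) ρ
      rw [show n - (j + 1) + 1 = n - j by omega] at e4
      obtain ⟨t', ρ', f1, f2, f3⟩ := ih (by omega) (ρ.set x (n - j)) e4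
      have e6 : ρ.set x ((Exp.add (.var x) (.lit 1)).eval ρ) = ρ.set x (n - j) := by
        simp only [Exp.eval, e3]
        congr 1; omega
      change Exec _ ρ _ (ρ.set x _) at e5
      rw [e6] at e5
      refine ⟨_, ρ', .loop_true (by simp only [Exp.eval, h1, h2]; omega) (.seq e1 e5) f1, ?_, f3⟩
      simp only [Com.bound, Exp.cost] at f2 ⊢
      rw [Nat.succ_mul]
      omega
  obtain ⟨t, ρ, h1, h2, h3⟩ := key n le_rfl _ (by simpa [Exp.eval] using h0)
  refine ⟨t, ρ, h1, h2.trans ?_, h3⟩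
  simp only [Com.bound]
  gcongr

end Rules

theorem Store.ext_of {σ τ : Store} (hr : ∀ x, σ.reg x = τ.reg x) (hm : σ.mem = τ.mem)
    (ho : σ.out = τ.out) : σ = τ := by
  cases σ; cases τ
  simp only [Store.mk.injEq]
  exact ⟨funext hr, hm, ho⟩

/-! ### Multiplication, division and powers of two by repeated addition and subtraction -/

section Arithmetic

variable {M : ℕ} {P : Com} {σ : Store} {Q : Store → Prop}

/-- Register `d` receives the product of the registers `a` and `b`. -/
def Com.mul (d a b : ℕ) : Com :=
  .seq (.assign d (.lit 0)) (.count 40 (.var a) (.assign d (.add (.var d) (.var b))))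

theorem Ends.mul {d a b : ℕ} (hd : d < 40) (ha : a < 40) (hb : b < 40) (had : a ≠ d) (hbd : b ≠ d)
    {va vb : ℕ} (hva : σ.reg a = va) (hvb : σ.reg b = vb) (hM : va ≤ M)
    (h : Q ((σ.set d (va * vb)).set 40 va)) : Ends M (.mul d a b) σ Q := by
  subst hva hvb
  refine .seq (.assign ?_)
  refine .count (n := σ.reg a) (fun i τ => τ = (σ.set d (i * σ.reg b)).set 40 i) hM ?_ ?_ ?_ ?_
  · simp [Exp.eval]
  · rintro i τ rfl
    simp [Exp.eval, had, ha.ne]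
  · rintro i - τ rfl
    refine .assign ⟨by simp [hd.ne'], ?_⟩
    refine Store.ext_of (fun x => ?_) rfl rfl
    simp only [Exp.eval, Store.set_reg, hd.ne, hb.ne, hbd, if_false, if_true]
    split_ifs <;> first | rfl | ring
  · rintro τ rfl
    exact h

/-- Registers `q` and `r` receive quotient and remainder of the registers `x` and `y`. -/
def Com.divMod (q r x y : ℕ) : Com :=
  .seq (.assign q (.lit 0)) (.seq (.assign r (.var x))
    (.count 40 (.var x) (.ite (.sub (.add (.var r) (.lit 1)) (.var y))
      (.seq (.assign r (.sub (.var r) (.var y))) (.assign q (.add (.var q) (.lit 1)))) .skip)))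

theorem Ends.divMod {q r x y : ℕ} (hq : q < 40) (hr : r < 40) (hx : x < 40) (hy : y < 40)
    (hqr : q ≠ r) (hxq : x ≠ q) (hxr : x ≠ r) (hyq : y ≠ q) (hyr : y ≠ r) 
    {vx vy : ℕ} (hvx : σ.reg x = vx) (hvy : σ.reg y = vy) (hM : vx ≤ M) (hpos : 0 < vy)
    (h : Q (((σ.set q (vx / vy)).set r (vx % vy)).set 40 vx)) :
    Ends M (.divMod q r x y) σ Q := by
  subst hvx hvy
  refine .seq (.assign (.seq (.assign ?_)))
  -- The loop makes x rounds, usually more than necessary. As long as the remainder b is at least y,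
  -- each round lowers it by at least one, so b + i ≤ x; after x rounds this forces b < y, because y
  -- is positive.
  refine .count (n := σ.reg x) (fun i τ => ∃ a b, τ = ((σ.set q a).set r b).set 40 i ∧
    σ.reg x = a * σ.reg y + b ∧ (b < σ.reg y ∨ b + i ≤ σ.reg x)) hM ?_ ?_ ?_ ?_
  · exact ⟨0, σ.reg x, by simp [Exp.eval, hxq], by simp, by simp⟩
  · rintro i τ ⟨a, b, rfl, -⟩
    simp [Exp.eval, hxq, hxr, hx.ne]
  · rintro i hi τ ⟨a, b, rfl, h1, h2⟩
    refine .ite (fun h => ?_) (fun h => ?_)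
    · simp only [Exp.eval, Store.set_reg, hr.ne, hy.ne, hyr, hyq, if_true, if_false] at h
      refine .seq (.assign (.assign ?_))
      refine ⟨by simp [hq.ne', hr.ne'], a + 1, b - σ.reg y, ?_, ?_, ?_⟩
      · refine Store.ext_of (fun x => ?_) rfl rfl
        simp only [Exp.eval, Store.set_reg, hr.ne, hq.ne, hy.ne, hyr, hyq, hqr, if_false, if_true]
        split_ifs <;> simp_all
      · rw [h1, Nat.succ_mul]; omega
      · omega
    · simp only [Exp.eval, Store.set_reg, hr.ne, hy.ne, hyr, hyq, if_true, if_false] at h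
      refine .skip ⟨by simp, a, b, ?_, h1, by omega⟩
      refine Store.ext_of (fun x => ?_) rfl rfl
      simp only [Store.set_reg]
      split_ifs <;> rfl
  · rintro τ ⟨a, b, rfl, h1, h2⟩
    have hb : b < σ.reg y := by
      rcases h2 with h2 | h2
      · exact h2
      · omega
    have e1 : σ.reg x / σ.reg y = a := by
      rw [h1, mul_comm, Nat.mul_add_div hpos, Nat.div_eq_of_lt hb, add_zero]
    have e2 : σ.reg x % σ.reg y = b := by
      rw [h1, mul_comm, Nat.mul_add_mod, Nat.mod_eq_of_lt hb]
    rwa [e1, e2] at h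

/-- Register `d` receives `2` to the power register `e`. -/
def Com.twoPow (d e : ℕ) : Com :=
  .seq (.assign d (.lit 1)) (.count 40 (.var e) (.assign d (.add (.var d) (.var d))))

theorem Ends.twoPow {d e : ℕ} (hd : d < 40) (he : e < 40) (hed : e ≠ d)
    {ve : ℕ} (hve : σ.reg e = ve) (hM : ve ≤ M) (h : Q ((σ.set d (2 ^ ve)).set 40 ve)) :
    Ends M (.twoPow d e) σ Q := by
  subst hve
  refine .seq (.assign ?_)
  refine .count (n := σ.reg e) (fun i τ => τ = (σ.set d (2 ^ i)).set 40 i) hM ?_ ?_ ?_ ?_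
  · simp [Exp.eval]
  · rintro i τ rfl
    simp [Exp.eval, hed, he.ne]
  · rintro i - τ rfl
    refine .assign ⟨by simp [hd.ne'], ?_⟩
    refine Store.ext_of (fun x => ?_) rfl rfl
    simp only [Exp.eval, Store.set_reg, hd.ne, if_false, if_true]
    split_ifs <;> first | rfl | ring
  · rintro τ rfl
    exact h

end Arithmetic

/-! ### Writing the adjacency matrix -/

/-- The order of the constructed graph, for `3 s` blocks of `s` variables and `m` clauses. -/
def graphOrder (s m : ℕ) : ℕ := 25 * s + 2 + 3 * s * 2 ^ s + m

/-- The registers that hold the dimensions of the construction. -/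
structure Env (s m : ℕ) (σ : Store) : Prop where
  r1 : σ.reg 1 = s
  r2 : σ.reg 2 = 3 * s
  r3 : σ.reg 3 = 2 ^ s
  r4 : σ.reg 4 = 4 * s + 2
  r5 : σ.reg 5 = 7 * s + 2
  r6 : σ.reg 6 = 10 * s + 2
  r7 : σ.reg 7 = 13 * s + 2
  r8 : σ.reg 8 = 16 * s + 2
  r9 : σ.reg 9 = 19 * s + 2
  r10 : σ.reg 10 = 25 * s + 2
  r11 : σ.reg 11 = 25 * s + 2 + 3 * s * 2 ^ s
  r12 : σ.reg 12 = graphOrder s m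
  r13 : σ.reg 13 = m
  r14 : σ.reg 14 = 4 * s - 1
  r15 : σ.reg 15 = 2 * s

theorem Env.congr {s m : ℕ} {σ τ : Store} (h : Env s m σ) (hr : ∀ r < 16, τ.reg r = σ.reg r) :
    Env s m τ := by
  obtain ⟨h1, h2, h3, h4, h5, h6, h7, h8, h9, h10, h11, h12, h13, h14, h15⟩ := h
  constructor <;> (rw [hr _ (by norm_num)]; assumption)

open Classical in
/-- Bank `1` holds the adjacency matrix of the relation `E`. -/
structure Holds (s m : ℕ) (w : List ℕ) (E : Set (ℕ × ℕ)) (σ : Store) : Prop where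
  env : Env s m σ
  input : ∀ i, σ.mem 0 i = w.getD i 0
  out : σ.out = []
  matrix : ∀ u < graphOrder s m, ∀ v < graphOrder s m,
    σ.mem 1 (u * graphOrder s m + v) = if (u, v) ∈ E then 1 else 0

/-- An edge, as a symmetric relation. -/
def link (u v : ℕ) : Set (ℕ × ℕ) := {(u, v), (v, u)}

theorem mul_add_inj {N x y x' y' : ℕ} (hy : y < N) (hy' : y' < N) :
    x * N + y = x' * N + y' ↔ x = x' ∧ y = y' := by
  refine ⟨fun h => ?_, by rintro ⟨rfl, rfl⟩; rfl⟩
  have hp : 0 < N := by omega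
  rw [mul_comm x, mul_comm x'] at h
  have h1 := congrArg (· / N) h
  have h2 := congrArg (· % N) h
  simp only [Nat.mul_add_div hp, Nat.div_eq_of_lt hy, Nat.div_eq_of_lt hy',
    Nat.mul_add_mod, Nat.mod_eq_of_lt hy, Nat.mod_eq_of_lt hy'] at h1 h2
  exact ⟨by simpa using h1, h2⟩

/-! ### A calculus of programs that add edges to the matrix -/

section Adds

variable {s m : ℕ} {w : List ℕ} {E F F' : Set (ℕ × ℕ)} {σ : Store} {P P' : Com} {c : ℕ}

theorem Holds.congr {τ : Store} (h : Holds s m w E σ) (hr : ∀ r < 16, τ.reg r = σ.reg r)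
    (hm : τ.mem = σ.mem) (ho : τ.out = σ.out) : Holds s m w E τ :=
  ⟨h.env.congr hr, hm ▸ h.input, ho ▸ h.out, hm ▸ h.matrix⟩

theorem Holds.set (h : Holds s m w E σ) {x : ℕ} (hx : 16 ≤ x) (v : ℕ) :
    Holds s m w E (σ.set x v) :=
  h.congr (fun r hr => by rw [Store.set_reg, if_neg (by omega)]) rfl rfl

/-- Started in `σ`, the program `P` adds the edges `F` to the matrix, whatever it contains, and
keeps the registers below `c`. -/
def Adds (s m : ℕ) (w : List ℕ) (c : ℕ) (P : Com) (σ : Store) (F : Set (ℕ × ℕ)) : Prop :=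
  ∀ E, Holds s m w E σ → Ends (graphOrder s m) P σ fun τ =>
    Holds s m w (E ∪ F) τ ∧ ∀ r < c, τ.reg r = σ.reg r

theorem Adds.seq (h : Adds s m w c P σ F)
    (h' : ∀ τ, Env s m τ → (∀ r < c, τ.reg r = σ.reg r) → Adds s m w c P' τ F') :
    Adds s m w c (.seq P P') σ (F ∪ F') := by
  intro E hE
  refine .seq ((h E hE).mono fun τ hτ => ?_)
  refine (h' τ hτ.1.env hτ.2 _ hτ.1).mono fun ρ hρ => ?_
  rw [Set.union_assoc] at hρ
  exact ⟨hρ.1, fun r hr => (hρ.2 r hr).trans (hτ.2 r hr)⟩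

theorem Adds.ite {e : Exp} {p : Prop} [Decidable p] (he : e.eval σ ≠ 0 ↔ p)
    (h : p → Adds s m w c P σ F) :
    Adds s m w c (.ite e P .skip) σ {x | p ∧ x ∈ F} := by
  intro E hE
  refine .ite (fun h0 => ?_) (fun h0 => ?_)
  · have hp := he.1 h0
    refine (h hp E hE).mono fun τ hτ => ?_
    simpa [hp] using hτ
  · have hp : ¬ p := fun hp => he.2 hp h0
    exact .skip ⟨by simpa [hp] using hE, fun _ _ => rfl⟩

/-- The counter is register `c` itself and the body must keep the registers below `c + 1`. Nested
loops therefore use increasing registers, and the inner ones cannot disturb the outer counters. -/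
theorem Adds.count {e : Exp} {n : ℕ} {F : ℕ → Set (ℕ × ℕ)} (hc : 16 ≤ c)
    (hn : n ≤ graphOrder s m) (he : ∀ τ, Env s m τ → (∀ r < c, τ.reg r = σ.reg r) → e.eval τ = n)
    (h : ∀ i < n, ∀ τ, Env s m τ → (∀ r < c, τ.reg r = σ.reg r) → τ.reg c = i →
      Adds s m w (c + 1) P τ (F i)) :
    Adds s m w c (.count c e P) σ {x | ∃ i < n, x ∈ F i} := by
  intro E hE
  refine .count (fun i τ => Holds s m w (E ∪ {x | ∃ j < i, x ∈ F j}) τ ∧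
    (∀ r < c, τ.reg r = σ.reg r) ∧ τ.reg c = i) hn ?_ ?_ ?_ ?_
  · refine ⟨by simpa using hE.set hc 0, fun r hr => ?_, by simp⟩
    rw [Store.set_reg, if_neg hr.ne]
  · rintro i τ ⟨h1, h2, h3⟩
    exact ⟨he τ h1.env h2, h3⟩
  · rintro i hi τ ⟨h1, h2, h3⟩
    refine (h i hi τ h1.env h2 h3 _ h1).mono fun ρ ⟨k1, k2⟩ => ⟨?_, ?_, fun r hr => ?_, by simp⟩
    · rw [k2 c (by omega), h3]
    · have : E ∪ {x | ∃ j < i, x ∈ F j} ∪ F i = E ∪ {x | ∃ j < i + 1, x ∈ F j} := by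
        ext x
        simp only [Set.mem_union, Set.mem_ofPred_eq, Nat.exists_lt_succ_right, or_assoc]
      rw [this] at k1
      exact k1.set hc _
    · rw [Store.set_reg, if_neg hr.ne, k2 r (by omega), h2 r hr]
  · rintro τ ⟨h1, h2, -⟩
    exact ⟨h1, h2⟩

theorem Adds.of_agree {τ : Store} {c' : ℕ} (h : Adds s m w c' P τ F) (hc : 16 ≤ c)
    (hcc : c ≤ c') (hr : ∀ r < c, τ.reg r = σ.reg r) (hm : τ.mem = σ.mem) (ho : τ.out = σ.out) :
    ∀ E, Holds s m w E σ →
      Ends (graphOrder s m) P τ fun ρ =>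
        Holds s m w (E ∪ F) ρ ∧ ∀ r < c, ρ.reg r = σ.reg r := fun E hE =>
  (h E (hE.congr (fun r h => hr r (by omega)) hm ho)).mono fun ρ hρ => ⟨hρ.1, fun r h => by
    rw [hρ.2 r (by omega), hr r h]⟩

theorem Adds.assign {x : ℕ} {e : Exp} (v : ℕ) (hv : e.eval σ = v) (side : 16 ≤ c ∧ c ≤ x)
    (h : Adds s m w c P (σ.set x v) F) : Adds s m w c (.seq (.assign x e) P) σ F := by
  subst hv
  exact fun E hE => .seq (.assign (h.of_agree (σ := σ) side.1 le_rfl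
    (fun r hr => by rw [Store.set_reg, if_neg (by omega)]) rfl rfl E hE))

theorem Adds.mul {d a b : ℕ} (va vb : ℕ) (hva : σ.reg a = va) (hvb : σ.reg b = vb)
    (hM : va ≤ graphOrder s m)
    (side : 16 ≤ c ∧ c ≤ d ∧ d < 40 ∧ a < 40 ∧ b < 40 ∧ a ≠ d ∧ b ≠ d)
    (h : Adds s m w c P ((σ.set d (va * vb)).set 40 va) F) :
    Adds s m w c (.seq (.mul d a b) P) σ F := by
  obtain ⟨hc, hx, hd, ha, hb, had, hbd⟩ := side
  refine fun E hE => .seq (.mul hd ha hb had hbd hva hvb hM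
    (h.of_agree (σ := σ) hc le_rfl (fun r hr => ?_) rfl rfl E hE))
  simp only [Store.set_reg]
  rw [if_neg (by omega), if_neg (by omega)]

theorem Adds.twoPow {d e : ℕ} (ve : ℕ) (hve : σ.reg e = ve) (hM : ve ≤ graphOrder s m)
    (side : 16 ≤ c ∧ c ≤ d ∧ d < 40 ∧ e < 40 ∧ e ≠ d)
    (h : Adds s m w c P ((σ.set d (2 ^ ve)).set 40 ve) F) :
    Adds s m w c (.seq (.twoPow d e) P) σ F := by
  obtain ⟨hc, hx, hd, he, hed⟩ := side
  refine fun E hE => .seq (.twoPow hd he hed hve hM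
    (h.of_agree (σ := σ) hc le_rfl (fun r hr => ?_) rfl rfl E hE))
  simp only [Store.set_reg]
  rw [if_neg (by omega), if_neg (by omega)]

theorem Adds.divMod {q r x y : ℕ} (vx vy : ℕ) (hvx : σ.reg x = vx) (hvy : σ.reg y = vy)
    (hM : vx ≤ graphOrder s m) (hpos : 0 < vy)
    (side : 16 ≤ c ∧ c ≤ q ∧ c ≤ r ∧ q < 40 ∧ r < 40 ∧ x < 40 ∧ y < 40 ∧ q ≠ r ∧ x ≠ q ∧ x ≠ r ∧
      y ≠ q ∧ y ≠ r)
    (h : Adds s m w c P (((σ.set q (vx / vy)).set r (vx % vy)).set 40 vx) F) :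
    Adds s m w c (.seq (.divMod q r x y) P) σ F := by
  obtain ⟨hc, hcq, hcr, hq, hr, hx, hy, hqr, hxq, hxr, hyq, hyr⟩ := side
  refine fun E hE => .seq (.divMod hq hr hx hy hqr hxq hxr hyq hyr hvx hvy hM hpos
    (h.of_agree (σ := σ) hc le_rfl (fun r hr => ?_) rfl rfl E hE))
  simp only [Store.set_reg]
  rw [if_neg (by omega), if_neg (by omega), if_neg (by omega)]

theorem Adds.mono {c' : ℕ} (h : Adds s m w c' P σ F) (hcc : c ≤ c') : Adds s m w c P σ F :=
  fun E hE => (h E hE).mono fun _ hτ => ⟨hτ.1, fun r hr => hτ.2 r (by omega)⟩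

/-- Add the edge between the vertices `e` and `e'` to the matrix. -/
def Com.mark (e e' : Exp) : Com :=
  .seq (.assign 36 e) (.seq (.assign 37 e')
    (.seq (.mul 38 36 12) (.seq (.store 1 (.add (.var 38) (.var 37)) (.lit 1))
      (.seq (.mul 38 37 12) (.store 1 (.add (.var 38) (.var 36)) (.lit 1))))))

/-- Row-major addresses are injective in row and column, so exactly the two intended cells change.
Writing a 1 over a 1 is harmless, hence the edge need not be new. -/
theorem Adds.mark {e e' : Exp} {u v : ℕ} (hc : c ≤ 36) (hu : e.eval σ = u)
    (hv : e'.eval (σ.set 36 u) = v) (hun : u < graphOrder s m) (hvn : v < graphOrder s m) :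
    Adds s m w c (.mark e e') σ (link u v) := by
  intro E hE
  have h12 : σ.reg 12 = graphOrder s m := hE.env.r12
  refine .seq (.assign (.seq (.assign (.seq ?_))))
  rw [hu, hv]
  refine .mul (va := u) (vb := graphOrder s m) (by norm_num) (by norm_num) (by norm_num)
    (by norm_num) (by norm_num) (by simp) (by simpa using h12) hun.le (.seq (.store (.seq ?_)))
  refine .mul (va := v) (vb := graphOrder s m) (by norm_num) (by norm_num) (by norm_num)
    (by norm_num) (by norm_num) (by simp) (by simpa using h12) hvn.le (.store ?_)
  refine ⟨⟨hE.env.congr fun r hr => ?_, fun i => ?_, hE.out, fun a ha b hb => ?_⟩, fun r hr => ?_⟩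
  · simp only [Store.put_reg, Store.set_reg]
    repeat rw [if_neg (by omega)]
  · simpa using hE.input i
  · have hm := hE.matrix a ha b hb
    simp only [Exp.eval, Store.put_mem, Store.put_reg, Store.set_reg, Store.set_mem, hm,
      reduceIte, Nat.reduceEqDiff, true_and, mul_add_inj hb hvn, mul_add_inj hb hun, link,
      Set.mem_union,
      Set.mem_insert_iff, Set.mem_singleton_iff, Prod.mk.injEq]
    grind
  · simp only [Store.put_reg, Store.set_reg]
    repeat rw [if_neg (by omega)]

end Adds

/-! ### The edges that do not depend on the clauses -/

/-- The number of the vertex for the assignment `α` of block `i`. -/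
def assignmentVertex (s i α : ℕ) : ℕ := 25 * s + 2 + (i * 2 ^ s + α)

/-- The number of the vertex for the value `b` of the `j`-th variables of the blocks of part
`δ`. -/
def valueVertex (s δ j b : ℕ) : ℕ := 19 * s + 2 + (δ * (2 * s) + (j + j + b))

/-- The unions and comprehensions are nested exactly as the marking programs are composed, so that
`Adds.seq`, `Adds.count` and `Adds.ite` produce these sets without any rewriting. -/
def assignmentLinks (s i α : ℕ) : Set (ℕ × ℕ) :=
  link 1 (assignmentVertex s i α) ∪ (link (13 * s + 2 + i) (assignmentVertex s i α) ∪
    ({x | ∃ j < 3 * s, x ∈ {x | i ≠ j ∧ x ∈ link (assignmentVertex s i α) (7 * s + 2 + j)}} ∪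
      {x | ∃ j < s, x ∈ link (assignmentVertex s i α) (valueVertex s (i / s) j (α / 2 ^ j % 2))}))

def blockLinks (s i : ℕ) : Set (ℕ × ℕ) :=
  link (4 * s + 2 + i) (7 * s + 2 + i) ∪ (link (4 * s + 2 + i) (10 * s + 2 + i) ∪
    (link (4 * s + 2 + i) (16 * s + 2 + i) ∪ (link (13 * s + 2 + i) (16 * s + 2 + i) ∪
      ({x | ∃ j < 3 * s, x ∈ {x | i ≠ j ∧ x ∈ link (4 * s + 2 + i) (4 * s + 2 + j)}} ∪
        {x | ∃ α < 2 ^ s, x ∈ assignmentLinks s i α}))))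

def frameLinks (s : ℕ) : Set (ℕ × ℕ) :=
  link 0 2 ∪ ({x | ∃ i < 3 * s, x ∈ link 0 (4 * s + 2 + i)} ∪
    ({x | ∃ i < 6 * s, x ∈ link 0 (19 * s + 2 + i)} ∪
      ({x | ∃ i < 4 * s - 1, x ∈ link 1 (3 + i)} ∪ {x | ∃ i < 3 * s, x ∈ blockLinks s i})))

/-- Nonzero if and only if the registers `a` and `b` differ. -/
def Exp.ne (a b : ℕ) : Exp := .add (.sub (.var a) (.var b)) (.sub (.var b) (.var a))

def Com.valueMarks : Com :=
  .count 22 (.var 1) (.seq (.twoPow 23 22) (.seq (.divMod 24 25 20 23) (.seq (.assign 23 (.lit 2))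
    (.seq (.divMod 25 26 24 23) (.mark (.var 21)
      (.add (.var 18) (.add (.add (.var 22) (.var 22)) (.var 26))))))))

def Com.assignmentMarks : Com :=
  .seq (.assign 21 (.add (.var 19) (.var 20))) (.seq (.mark (.lit 1) (.var 21))
    (.seq (.mark (.add (.var 7) (.var 16)) (.var 21)) (.seq
      (.count 22 (.var 2) (.ite (.ne 16 22) (.mark (.var 21) (.add (.var 5) (.var 22))) .skip))
      .valueMarks)))

def Com.blockMarks : Com :=
  .seq (.mark (.add (.var 4) (.var 16)) (.add (.var 5) (.var 16)))
  (.seq (.mark (.add (.var 4) (.var 16)) (.add (.var 6) (.var 16)))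
  (.seq (.mark (.add (.var 4) (.var 16)) (.add (.var 8) (.var 16)))
  (.seq (.mark (.add (.var 7) (.var 16)) (.add (.var 8) (.var 16)))
  (.seq (.count 17 (.var 2)
    (.ite (.ne 16 17) (.mark (.add (.var 4) (.var 16)) (.add (.var 4) (.var 17))) .skip))
  (.seq (.divMod 17 18 16 1) (.seq (.mul 18 17 15) (.seq (.assign 18 (.add (.var 9) (.var 18)))
  (.seq (.mul 19 16 3) (.seq (.assign 19 (.add (.var 10) (.var 19)))
  (.count 20 (.var 3) .assignmentMarks))))))))))

def Com.frameMarks : Com :=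
  .seq (.mark (.lit 0) (.lit 2))
  (.seq (.count 16 (.var 2) (.mark (.lit 0) (.add (.var 4) (.var 16))))
  (.seq (.count 16 (.add (.var 2) (.var 2)) (.mark (.lit 0) (.add (.var 9) (.var 16))))
  (.seq (.count 16 (.var 14) (.mark (.lit 1) (.add (.lit 3) (.var 16))))
  (.count 16 (.var 2) .blockMarks))))

section

variable {s m : ℕ} {w : List ℕ} {σ : Store}

theorem index_lt {i α n p : ℕ} (hi : i < n) (hα : α < p) : i * p + α < n * p :=
  calc i * p + α < (i + 1) * p := by rw [Nat.succ_mul]; omega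
    _ ≤ n * p := Nat.mul_le_mul_right _ hi

theorem le_graphOrder (s m : ℕ) : 25 * s + 2 + 3 * s * 2 ^ s + m ≤ graphOrder s m := le_rfl

theorem two_pow_le_graphOrder (hs : 0 < s) : 2 ^ s ≤ graphOrder s m := by
  have h1 : 1 * 2 ^ s ≤ 3 * s * 2 ^ s := Nat.mul_le_mul_right _ (by omega)
  have := le_graphOrder s m
  omega

theorem assignmentVertex_lt {i α : ℕ} (hi : i < 3 * s) (hα : α < 2 ^ s) :
    assignmentVertex s i α < graphOrder s m := by
  have := index_lt hi hα
  have := le_graphOrder s m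
  unfold assignmentVertex
  omega

theorem valueVertex_lt {δ j b : ℕ} (hδ : δ < 3) (hj : j < s) (hb : b < 2) :
    valueVertex s δ j b < 25 * s + 2 := by
  have : δ * (2 * s) + (j + j + b) < 3 * (2 * s) := index_lt hδ (by omega)
  unfold valueVertex
  omega

theorem Exp.ne_eval {a b : ℕ} (τ : Store) : (Exp.ne a b).eval τ ≠ 0 ↔ τ.reg a ≠ τ.reg b := by
  simp only [Exp.ne, Exp.eval]
  omega

theorem Adds.valueMarks {i α : ℕ} (hs : 0 < s) (hi : i < 3 * s) (hα : α < 2 ^ s)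
    (h18 : σ.reg 18 = 19 * s + 2 + i / s * (2 * s)) (h20 : σ.reg 20 = α)
    (h21 : σ.reg 21 = assignmentVertex s i α) :
    Adds s m w 22 .valueMarks σ {x | ∃ j < s, x ∈
      link (assignmentVertex s i α) (valueVertex s (i / s) j (α / 2 ^ j % 2))} := by
  have hN := le_graphOrder s m
  refine .count (by norm_num) (by omega) (fun τ h _ => h.r1) fun j hj τ h hτ h22 => ?_
  have k18 := (hτ 18 (by norm_num)).trans h18
  have k20 := (hτ 20 (by norm_num)).trans h20
  have k21 := (hτ 21 (by norm_num)).trans h21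
  have hα' := hα.le.trans (two_pow_le_graphOrder (m := m) hs)
  refine .twoPow j h22 (by omega) (by decide) ?_
  refine .divMod α (2 ^ j) (by simpa using k20) (by simp) hα' (by positivity) (by decide) ?_
  refine .assign 2 rfl (by decide) ?_
  refine .divMod (α / 2 ^ j) 2 (by simp) (by simp) ((Nat.div_le_self _ _).trans hα') (by norm_num)
    (by decide) ?_
  refine .mark (by norm_num) (by simpa [Exp.eval] using k21) ?_ (assignmentVertex_lt hi hα) ?_
  · simp [Exp.eval, k18, h22, valueVertex]
    ring
  · exact (valueVertex_lt (Nat.div_lt_of_lt_mul (by linarith)) hj (Nat.mod_lt _ two_pos)).trans_le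
      (by omega)

theorem Adds.assignmentMarks {i α : ℕ} (hs : 0 < s) (hi : i < 3 * s) (hα : α < 2 ^ s)
    (h16 : σ.reg 16 = i) (h18 : σ.reg 18 = 19 * s + 2 + i / s * (2 * s))
    (h19 : σ.reg 19 = 25 * s + 2 + i * 2 ^ s) (h20 : σ.reg 20 = α) :
    Adds s m w 21 .assignmentMarks σ (assignmentLinks s i α) := by
  have hN := le_graphOrder s m
  have ha := assignmentVertex_lt (m := m) hi hα
  refine .assign (assignmentVertex s i α) ?_ (by decide) ?_
  · simp [Exp.eval, h19, h20, assignmentVertex, add_assoc]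
  refine .mono (c' := 22) (.seq (.mark (by norm_num) rfl (by simp [Exp.eval]) (by omega) ha)
    fun τ h hτ => ?_) (by norm_num)
  refine .seq (.mark (by norm_num) ?_ ?_ (by omega) ha) fun τ' h' hτ' => ?_
  · simp [Exp.eval, h.r7, hτ, h16]
  · simp [Exp.eval, hτ]
  have k16 : τ'.reg 16 = i := by simp [hτ, hτ', h16]
  have k21 : τ'.reg 21 = assignmentVertex s i α := by simp [hτ, hτ']
  refine .seq (.count (by norm_num) (by omega) (fun τ h _ => h.r2) fun j hj ρ h hρ h22 => ?_)
    fun ρ h hρ => .valueMarks hs hi hα ?_ ?_ ?_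
  · refine .ite (by simp [Exp.ne_eval, hρ, k16, h22]) fun _ => ?_
    refine .mark (by norm_num) ?_ ?_ ha (by omega)
    · simp [Exp.eval, hρ, k21]
    · simp [Exp.eval, h.r5, h22]
  · simp [hρ, hτ, hτ', h18]
  · simp [hρ, hτ, hτ', h20]
  · simp [hρ, k21]

theorem Adds.blockMarks {i : ℕ} (hs : 0 < s) (hi : i < 3 * s) (henv : Env s m σ)
    (h16 : σ.reg 16 = i) : Adds s m w 17 .blockMarks σ (blockLinks s i) := by
  have hN := le_graphOrder s m
  have mark (x y : ℕ) (τ : Store) (hτ : ∀ r < 17, τ.reg r = σ.reg r)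
      (hx : x < 16) (hy : y < 16) (u v : ℕ) (hu : σ.reg x = u) (hv : σ.reg y = v)
      (hun : u + i < graphOrder s m) (hvn : v + i < graphOrder s m) :
      Adds s m w 17 (.mark (.add (.var x) (.var 16)) (.add (.var y) (.var 16))) τ
        (link (u + i) (v + i)) := by
    refine .mark (by norm_num) ?_ ?_ hun hvn
    · simp [Exp.eval, hτ x (by omega), hτ 16 (by omega), hu, h16]
    · simp [Exp.eval, show y ≠ 36 by omega, hτ y (by omega), hτ 16 (by omega), hv, h16]
  refine .seq (mark 4 5 σ (fun _ _ => rfl) (by decide) (by decide) _ _ henv.r4 henv.r5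
    (by omega) (by omega)) fun τ₁ _ k₁ => ?_
  refine .seq (mark 4 6 τ₁ k₁ (by decide) (by decide) _ _ henv.r4 henv.r6
    (by omega) (by omega)) fun τ₂ _ k₂ => ?_
  replace k₂ (r) (hr : r < 17) := (k₂ r hr).trans (k₁ r hr)
  refine .seq (mark 4 8 τ₂ k₂ (by decide) (by decide) _ _ henv.r4 henv.r8
    (by omega) (by omega)) fun τ₃ _ k₃ => ?_
  replace k₃ (r) (hr : r < 17) := (k₃ r hr).trans (k₂ r hr)
  refine .seq (mark 7 8 τ₃ k₃ (by decide) (by decide) _ _ henv.r7 henv.r8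
    (by omega) (by omega)) fun τ₄ _ k₄ => ?_
  replace k₄ (r) (hr : r < 17) := (k₄ r hr).trans (k₃ r hr)
  refine .seq (.count (by norm_num) (by omega) (fun τ h _ => h.r2) fun j hj ρ h hρ h17 => ?_)
    fun ρ h hρ => ?_
  · have k16 : ρ.reg 16 = i := by simp [hρ, k₄, h16]
    refine .ite (by simp [Exp.ne_eval, k16, h17]) fun _ => ?_
    refine .mark (by norm_num) ?_ ?_ (by omega) (by omega)
    · simp [Exp.eval, h.r4, k16]
    · simp [Exp.eval, h.r4, h17]
  have k16 : ρ.reg 16 = i := by simp [hρ, k₄, h16]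
  refine .divMod i s k16 h.r1 (by omega) hs (by decide) ?_
  have hd : i / s < 3 := Nat.div_lt_of_lt_mul (by linarith)
  refine .mul (i / s) (2 * s) (by simp) (by simp [h.r15]) (by omega) (by decide) ?_
  refine .assign (19 * s + 2 + i / s * (2 * s)) (by simp [Exp.eval, h.r9]) (by decide) ?_
  refine .mul i (2 ^ s) (by simp [k16]) (by simp [h.r3]) (by omega) (by decide) ?_
  refine .assign (25 * s + 2 + i * 2 ^ s) (by simp [Exp.eval, h.r10]) (by decide) ?_
  refine .mono (c' := 20) (.count (by norm_num) (two_pow_le_graphOrder hs) (fun τ h _ => h.r3)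
    fun α hα τ _ hτ h20 => .assignmentMarks hs hi hα ?_ ?_ ?_ h20) (by norm_num)
  · simp [hτ, k16]
  · simp [hτ]
  · simp [hτ]

theorem Adds.frameMarks (hs : 0 < s) : Adds s m w 16 .frameMarks σ (frameLinks s) := by
  have hN := le_graphOrder s m
  refine .seq (.mark (by norm_num) rfl rfl (by omega) (by omega)) fun τ _ _ => ?_
  refine .seq (.count le_rfl (by omega) (fun τ h _ => h.r2) fun i hi τ h hτ h16 => ?_)
    fun τ _ _ => ?_
  · exact .mark (by norm_num) rfl (by simp [Exp.eval, h.r4, h16]) (by omega) (by omega)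
  refine .seq (.count le_rfl (by omega) (fun τ h _ => by simp only [Exp.eval, h.r2]; omega)
    fun i hi τ h hτ h16 => ?_) fun τ _ _ => ?_
  · exact .mark (by norm_num) rfl (by simp [Exp.eval, h.r9, h16]) (by omega) (by omega)
  refine .seq (.count le_rfl (by omega) (fun τ h _ => h.r14) fun i hi τ h hτ h16 => ?_)
    fun τ _ _ => ?_
  · exact .mark (by norm_num) rfl (by simp [Exp.eval, h16]) (by omega) (by omega)
  exact .count le_rfl (by omega) (fun τ h _ => h.r2) fun i hi τ h _ h16 => .blockMarks hs hi h h16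

end

/-! ### The edges at the clauses -/

def litWord (C : List (ℕ × ℕ × ℕ)) : List ℕ := C.flatMap fun l => [l.1, l.2.1, l.2.2]

/-- The word that lists the clauses `cl`, given by triples (part, index, sign). -/
def clauseWord (cl : List (List (ℕ × ℕ × ℕ))) : List ℕ :=
  cl.flatMap fun C => C.length :: litWord C

/-- The number of the vertex of the `c`-th clause. -/
def clauseVertex (s c : ℕ) : ℕ := 25 * s + 2 + 3 * s * 2 ^ s + c

def literalLinks (s c : ℕ) (l : ℕ × ℕ × ℕ) : Set (ℕ × ℕ) :=
  link (clauseVertex s c) (4 * s + 2 + (l.1 * s + l.2.1 / s)) ∪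
    link (clauseVertex s c) (valueVertex s l.1 (l.2.1 % s) l.2.2)

def clauseLinks (s : ℕ) (cl : List (List (ℕ × ℕ × ℕ))) : Set (ℕ × ℕ) :=
  {x | ∃ c < cl.length, ∃ l ∈ cl.getD c [], x ∈ literalLinks s c l}

def Com.literalMarks : Com :=
  .seq (.assign 20 (.get 0 (.var 16))) (.seq (.assign 21 (.get 0 (.add (.var 16) (.lit 1))))
  (.seq (.assign 22 (.get 0 (.add (.var 16) (.lit 2)))) (.seq (.mul 23 20 1)
  (.seq (.divMod 24 25 21 1) (.seq (.mul 26 20 15)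
  (.seq (.mark (.add (.var 11) (.var 17)) (.add (.var 4) (.add (.var 23) (.var 24))))
  (.mark (.add (.var 11) (.var 17))
    (.add (.var 9) (.add (.var 26) (.add (.add (.var 25) (.var 25)) (.var 22)))))))))))

def Com.clauseMarks : Com :=
  .seq (.assign 16 (.lit 2)) (.count 17 (.var 13)
    (.seq (.assign 18 (.get 0 (.var 16))) (.seq (.assign 16 (.add (.var 16) (.lit 1)))
      (.count 19 (.var 18) (.seq .literalMarks (.assign 16 (.add (.var 16) (.lit 3))))))))

section

variable {s m n : ℕ} {w : List ℕ} {E : Set (ℕ × ℕ)} {σ : Store}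

/-- The literals of an instance with `3 s` blocks of `s` variables. -/
def IsLit (s : ℕ) (l : ℕ × ℕ × ℕ) : Prop := l.1 < 3 ∧ l.2.1 < s * s ∧ l.2.2 < 2

/-- Division takes as many rounds as its dividend is large. This keeps the division of a variable
index, which is below s², within the round limit. -/
theorem sq_le_graphOrder : s * s ≤ graphOrder s m := by
  have h1 : s * s ≤ 3 * s * 2 ^ s := Nat.mul_le_mul (by omega) Nat.lt_two_pow_self.le
  have := le_graphOrder s m
  omega

theorem Adds.literalMarks {c : ℕ} {l : ℕ × ℕ × ℕ} (hs : 0 < s) (hc : c < m) (hl : IsLit s l)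
    (henv : Env s m σ) (h17 : σ.reg 17 = c) (h0 : σ.mem 0 (σ.reg 16) = l.1)
    (h1 : σ.mem 0 (σ.reg 16 + 1) = l.2.1) (h2 : σ.mem 0 (σ.reg 16 + 2) = l.2.2) :
    Adds s m w 20 .literalMarks σ (literalLinks s c l) := by
  have hN := le_graphOrder s m
  obtain ⟨l0, l1, l2⟩ := hl
  have hsq := sq_le_graphOrder (s := s) (m := m)
  have hC : clauseVertex s c < graphOrder s m := by unfold clauseVertex; omega
  have hV : l.1 * s + l.2.1 / s < 3 * s := index_lt l0 (Nat.div_lt_of_lt_mul l1)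
  have hT := valueVertex_lt l0 (Nat.mod_lt l.2.1 hs) l2
  refine .assign l.1 (by simp [Exp.eval, h0]) (by decide) ?_
  refine .assign l.2.1 (by simp [Exp.eval, h1]) (by decide) ?_
  refine .assign l.2.2 (by simp [Exp.eval, h2]) (by decide) ?_
  refine .mul l.1 s (by simp) (by simp [henv.r1]) (by omega) (by decide) ?_
  refine .divMod l.2.1 s (by simp) (by simp [henv.r1]) (by omega) hs (by decide) ?_
  refine .mul l.1 (2 * s) (by simp) (by simp [henv.r15]) (by omega) (by decide) ?_
  refine .mono (c' := 27) (.seq (.mark (by norm_num) ?_ ?_ hC (by omega)) fun τ h hτ =>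
    .mark (by norm_num) ?_ ?_ hC (by omega)) (by norm_num)
  · simp [Exp.eval, henv.r11, h17, clauseVertex]
  · simp [Exp.eval, henv.r4]
  · simp [Exp.eval, henv.r11, hτ, h17, clauseVertex]
  · simp [Exp.eval, hτ, henv.r9, valueVertex]

theorem getD_of_drop_eq {l : List ℕ} {i : ℕ} {p r : List ℕ} (h : l.drop i = p ++ r) {j : ℕ}
    (hj : j < p.length) : l.getD (i + j) 0 = p.getD j 0 := by
  have h1 := congrArg (fun l => l[j]?) h
  simp only [List.getElem?_drop, List.getElem?_append_left hj] at h1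
  rw [List.getD_eq_getElem?_getD, h1, List.getD_eq_getElem?_getD]

theorem drop_add_of_drop_eq {l : List ℕ} {i : ℕ} {p r : List ℕ} (h : l.drop i = p ++ r) :
    l.drop (i + p.length) = r := by
  rw [← List.drop_drop, h, List.drop_left]

theorem Ends.literals {c : ℕ} {C : List (ℕ × ℕ × ℕ)} {rest : List ℕ} (hs : 0 < s) (hc : c < m)
    (hlen : C.length ≤ 3) (hC : ∀ l ∈ C, IsLit s l) (hE : Holds s m w E σ) (h17 : σ.reg 17 = c)
    (h18 : σ.reg 18 = C.length) (hpos : w.drop (σ.reg 16) = litWord C ++ rest) :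
    Ends (graphOrder s m)
      (.count 19 (.var 18) (.seq .literalMarks (.assign 16 (.add (.var 16) (.lit 3))))) σ fun τ =>
      Holds s m w (E ∪ {x | ∃ l ∈ C, x ∈ literalLinks s c l}) τ ∧ τ.reg 17 = c ∧
        w.drop (τ.reg 16) = rest := by
  have hN := le_graphOrder s m
  -- Register 16 is the reading position; the invariant says that the unread input starts with the
  -- literals still to be treated.
  refine .count (n := C.length) (fun j τ =>
    Holds s m w (E ∪ {x | ∃ l ∈ C.take j, x ∈ literalLinks s c l}) τ ∧ τ.reg 17 = c ∧
      τ.reg 18 = C.length ∧ τ.reg 19 = j ∧ w.drop (τ.reg 16) = litWord (C.drop j) ++ rest)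
    (by omega) ?_ ?_ ?_ ?_
  · exact ⟨by simpa using hE.set (x := 19) (by norm_num) 0, by simpa, by simpa, by simp, by simpa⟩
  · rintro j τ ⟨-, -, h1, h2, -⟩
    exact ⟨h1, h2⟩
  · rintro j hj τ ⟨k0, k1, k2, k3, k4⟩
    rw [List.drop_eq_getElem_cons hj] at k4
    set l := C[j] with hl
    have k5 : w.drop (τ.reg 16) = [l.1, l.2.1, l.2.2] ++ (litWord (C.drop (j + 1)) ++ rest) := by
      rw [k4]; simp [litWord]
    refine .seq ((Adds.literalMarks (w := w) hs hc (hC l (List.getElem_mem hj)) k0.env k1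
      ?_ ?_ ?_ _ k0).mono fun ρ hρ => .assign ?_)
    · rw [k0.input]; exact getD_of_drop_eq k5 (j := 0) (by simp)
    · rw [k0.input]; exact getD_of_drop_eq k5 (j := 1) (by simp)
    · rw [k0.input]; exact getD_of_drop_eq k5 (j := 2) (by simp)
    obtain ⟨hρ, kρ⟩ := hρ
    refine ⟨by simp [kρ, k3], ?_, by simp [kρ, k1], by simp [kρ, k2], by simp, ?_⟩
    · have : E ∪ {x | ∃ l ∈ C.take j, x ∈ literalLinks s c l} ∪ literalLinks s c l =
          E ∪ {x | ∃ l ∈ C.take (j + 1), x ∈ literalLinks s c l} := by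
        ext x
        rw [List.take_succ_eq_append_getElem hj]
        simp only [Set.mem_union, Set.mem_ofPred_eq, List.mem_append, List.mem_singleton,
          or_and_right,
          exists_or, exists_eq_left, or_assoc, ← hl]
      rw [this] at hρ
      exact (hρ.set (by norm_num) _).set (by norm_num) _
    · simpa [Exp.eval, kρ] using drop_add_of_drop_eq k5
  · rintro τ ⟨k0, k1, -, -, k4⟩
    exact ⟨by simpa using k0, k1, by simpa [litWord] using k4⟩

theorem Ends.clauseMarks {cl : List (List (ℕ × ℕ × ℕ))} (hs : 0 < s) (hm : m = cl.length)
    (hlen : ∀ C ∈ cl, C.length ≤ 3) (hcl : ∀ C ∈ cl, ∀ l ∈ C, IsLit s l) (hE : Holds s m w E σ)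
    (hw : w = n :: m :: clauseWord cl) :
    Ends (graphOrder s m) .clauseMarks σ fun τ => Holds s m w (E ∪ clauseLinks s cl) τ := by
  have hN := le_graphOrder s m
  refine .seq (.assign (.count (n := cl.length) (fun c τ =>
    Holds s m w (E ∪ {x | ∃ d < c, ∃ l ∈ cl.getD d [], x ∈ literalLinks s d l}) τ ∧
      τ.reg 17 = c ∧ w.drop (τ.reg 16) = clauseWord (cl.drop c)) (by omega) ?_ ?_ ?_ ?_))
  · refine ⟨?_, by simp, by simp [Exp.eval, hw]⟩
    simpa [Exp.eval] using (hE.set (x := 16) (by norm_num) 2).set (x := 17) (by norm_num) 0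
  · rintro c τ ⟨h0, h1, -⟩
    exact ⟨hm ▸ h0.env.r13, h1⟩
  · rintro c hc τ ⟨k0, k1, k2⟩
    have hmem : cl[c] ∈ cl := List.getElem_mem hc
    rw [List.drop_eq_getElem_cons hc] at k2
    have k3 : w.drop (τ.reg 16) =
        [cl[c].length] ++ (litWord cl[c] ++ clauseWord (cl.drop (c + 1))) := by
      rw [k2]
      simp only [clauseWord, List.flatMap_cons, List.cons_append, List.nil_append]
    have k4 : τ.mem 0 (τ.reg 16) = cl[c].length := by
      rw [k0.input]; exact getD_of_drop_eq k3 (j := 0) (by simp)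
    refine .seq (.assign (.seq (.assign ?_)))
    refine (Ends.literals (C := cl[c]) (rest := clauseWord (cl.drop (c + 1))) hs (hm ▸ hc)
      (hlen _ hmem) (hcl _ hmem)
      ((k0.set (by norm_num) _).set (by norm_num) _) (by simpa using k1) ?_ ?_).mono ?_
    · simp [Exp.eval, k4]
    · simpa [Exp.eval] using drop_add_of_drop_eq k3
    · rintro ρ ⟨h1, h2, h3⟩
      refine ⟨h2, ?_, by simp, by simpa using h3⟩
      have : E ∪ {x | ∃ d < c, ∃ l ∈ cl.getD d [], x ∈ literalLinks s d l} ∪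
          {x | ∃ l ∈ cl[c], x ∈ literalLinks s c l} =
          E ∪ {x | ∃ d < c + 1, ∃ l ∈ cl.getD d [], x ∈ literalLinks s d l} := by
        ext x
        simp only [Set.mem_union, Set.mem_ofPred_eq, Nat.exists_lt_succ_right, or_assoc]
        rw [List.getD_eq_getElem _ _ hc]
      rw [this] at h1
      exact h1.set (by norm_num) _
  · rintro τ ⟨h, -⟩
    exact h

/-! ### The dimensions -/

/-- The number of variables in a block, which is `⌈√n⌉` for positive `n`. -/
def blockSize (n : ℕ) : ℕ := Nat.sqrt (n - 1) + 1

theorem le_blockSize_sq (n : ℕ) : n ≤ blockSize n * blockSize n := by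
  have := Nat.lt_succ_sqrt (n - 1)
  unfold blockSize
  simp only [Nat.succ_eq_add_one] at this
  omega

theorem blockSize_le {n a : ℕ} (ha : 0 < a) (h : n ≤ a * a) : blockSize n ≤ a := by
  unfold blockSize
  rcases Nat.eq_zero_or_pos n with rfl | hn
  · simp only [zero_tsub, Nat.sqrt_zero]; omega
  · exact Nat.sqrt_lt.2 (by omega)

def Com.dimensions : Com :=
  .seq (.assign 1 (.lit 1)) (.seq (.assign 16 (.lit 1)) (.seq (.assign 17 (.get 0 (.lit 0)))
  (.seq (.count 18 (.var 17) (.ite (.sub (.var 17) (.var 16))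
    (.seq (.assign 16 (.add (.add (.var 16) (.lit 1)) (.add (.var 1) (.var 1))))
      (.assign 1 (.add (.var 1) (.lit 1)))) .skip))
  (.seq (.assign 2 (.add (.var 1) (.add (.var 1) (.var 1)))) (.seq (.twoPow 3 1)
  (.seq (.assign 4 (.add (.var 2) (.add (.var 1) (.lit 2))))
  (.seq (.assign 5 (.add (.var 4) (.var 2))) (.seq (.assign 6 (.add (.var 5) (.var 2)))
  (.seq (.assign 7 (.add (.var 6) (.var 2))) (.seq (.assign 8 (.add (.var 7) (.var 2)))
  (.seq (.assign 9 (.add (.var 8) (.var 2)))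
  (.seq (.assign 10 (.add (.var 9) (.add (.var 2) (.var 2))))
  (.seq (.mul 11 2 3) (.seq (.assign 11 (.add (.var 10) (.var 11)))
  (.seq (.assign 13 (.get 0 (.lit 1))) (.seq (.assign 12 (.add (.var 11) (.var 13)))
  (.seq (.assign 14 (.sub (.var 4) (.lit 3))) (.assign 15 (.add (.var 1) (.var 1))))))))))))))))))))

theorem Ends.assign_seq {M x v : ℕ} {e : Exp} {P : Com} {Q : Store → Prop} (hv : e.eval σ = v)
    (h : Ends M P (σ.set x v) Q) : Ends M (.seq (.assign x e) P) σ Q :=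
  .seq (.assign (hv ▸ h))

theorem Ends.dimensions (hs : s = blockSize n) (hw : w.getD 0 0 = n) (hm : w.getD 1 0 = m) :
    Ends (graphOrder s m) .dimensions (initial w) (Holds s m w ∅) := by
  have hN := le_graphOrder s m
  have hsq := sq_le_graphOrder (s := s) (m := m)
  have hn := le_blockSize_sq n
  rw [← hs] at hn
  refine .seq (.assign (.seq (.assign (.seq (.assign (.seq ?_))))))
  -- Square root without multiplication: a is raised while a² < n, and a² is updated by (a+1)² = a²
  -- + 1 + 2a. Since a starts at 1, either a² has reached n or a = i + 1 after i rounds, so n rounds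
  -- suffice.
  refine .count (n := n) (fun i τ => τ.mem = (initial w).mem ∧ τ.out = [] ∧ τ.reg 18 = i ∧
    τ.reg 17 = n ∧ ∃ a, τ.reg 1 = a ∧ τ.reg 16 = a * a ∧ 0 < a ∧ a ≤ s ∧ (n ≤ a * a ∨ a = i + 1))
    (by omega) ?_ ?_ ?_ ?_
  · refine ⟨rfl, rfl, by simp, by simpa [Exp.eval, initial] using hw, 1, ?_⟩
    simp [Exp.eval, hs, blockSize]
  · rintro i τ ⟨-, -, h1, h2, -⟩
    exact ⟨h2, h1⟩
  · rintro i hi τ ⟨hm, ho, h18, h17, a, h1, h16, ha, has, h⟩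
    refine .ite (fun he => .seq (.assign (.assign ?_))) (fun he => .skip ?_)
    · simp only [Exp.eval, h17, h16] at he
      have has : a < s := by
        by_contra hlt
        have : s * s ≤ a * a := Nat.mul_le_mul (by omega) (by omega)
        omega
      refine ⟨by simpa using h18, hm, ho, by simp, by simpa using h17, a + 1,
        by simp [Exp.eval, h1],
        ?_, by omega, by omega, by omega⟩
      simp [Exp.eval, h1, h16]
      ring
    · simp only [Exp.eval, h17, h16] at he
      exact ⟨h18, hm, ho, by simp, by simpa using h17, a, by simpa, by simpa, ha, has,
        .inl (by omega)⟩
  rintro τ ⟨hmem, ho, -, h17, a, h1, h16, ha, has, h⟩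
  have hna : n ≤ a * a := by
    rcases h with h | rfl
    · exact h
    · nlinarith
  obtain rfl : a = s := le_antisymm has (hs ▸ blockSize_le ha hna)
  refine .assign_seq (v := 3 * a) (by simp only [Exp.eval, h1]; ring) (.seq ?_)
  refine .twoPow (ve := a) (by norm_num) (by norm_num) (by norm_num) (by simpa) (by omega) ?_
  refine .assign_seq (v := 4 * a + 2) (by simp [Exp.eval, h1]; ring) ?_
  refine .assign_seq (v := 7 * a + 2) (by simp [Exp.eval]; ring) ?_
  refine .assign_seq (v := 10 * a + 2) (by simp [Exp.eval]; ring) ?_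
  refine .assign_seq (v := 13 * a + 2) (by simp [Exp.eval]; ring) ?_
  refine .assign_seq (v := 16 * a + 2) (by simp [Exp.eval]; ring) ?_
  refine .assign_seq (v := 19 * a + 2) (by simp [Exp.eval]; ring) ?_
  refine .assign_seq (v := 25 * a + 2) (by simp [Exp.eval]; ring) (.seq ?_)
  refine .mul (va := 3 * a) (vb := 2 ^ a) (by norm_num) (by norm_num) (by norm_num) (by norm_num)
    (by norm_num) (by simp) (by simp) (by omega) ?_
  refine .assign_seq (v := 25 * a + 2 + 3 * a * 2 ^ a) (by simp [Exp.eval]) ?_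
  refine .assign_seq (v := m) (by simpa [Exp.eval, hmem, initial] using hm) ?_
  refine .assign_seq (v := graphOrder a m) (by simp [Exp.eval, graphOrder]) ?_
  refine .assign_seq (v := 4 * a - 1) (by simp [Exp.eval]) ?_
  refine .assign ⟨?_, fun i => ?_, ho, fun u _ v _ => ?_⟩
  · constructor <;> simp [Exp.eval, h1, two_mul]
  · simp [hmem, initial]
  · simp [hmem, initial]

/-! ### The output -/

def Com.output : Com :=
  .seq (.print (.add (.var 1) (.add (.var 2) (.add (.var 2) (.var 2))))) (.seq (.print (.var 12))
    (.count 16 (.var 12) (.count 17 (.var 12) (.seq (.mul 18 16 12)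
      (.print (.get 1 (.add (.var 18) (.var 17))))))))

open Classical in
/-- The output word for the graph on `0, …, N - 1` with adjacency relation `E`. -/
noncomputable def graphWord (k N : ℕ) (E : Set (ℕ × ℕ)) : List ℕ :=
  k :: N :: (List.range N).flatMap fun u => (List.range N).map fun v => if (u, v) ∈ E then 1 else 0

open Classical in
theorem Ends.output (hE : Holds s m w E σ) :
    Ends (graphOrder s m) .output σ fun τ => τ.out = graphWord (10 * s) (graphOrder s m) E := by
  set N := graphOrder s m with hN
  let row (u : ℕ) (v : ℕ) : ℕ := if (u, v) ∈ E then 1 else 0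
  refine .seq (.print (.seq (.print ?_)))
  refine .count (n := N) (fun i τ => τ.reg 12 = N ∧ τ.mem = σ.mem ∧ τ.reg 16 = i ∧
    τ.out = 10 * s :: N :: (List.range i).flatMap fun u => (List.range N).map (row u)) le_rfl
    ?_ ?_ ?_ ?_
  · refine ⟨by simpa using hE.env.r12, rfl, by simp, ?_⟩
    simp only [Exp.eval, hE.out, hE.env.r1, hE.env.r2, hE.env.r12, Store.set_out]
    simp only [List.range_zero, List.flatMap_nil, List.nil_append, List.cons_append, hN]
    congr 1
    ring
  · rintro i τ ⟨h1, -, h2, -⟩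
    exact ⟨h1, h2⟩
  · rintro i hi τ ⟨h1, h2, h3, h4⟩
    refine .count (n := N) (fun j ρ => ρ.reg 12 = N ∧ ρ.mem = σ.mem ∧ ρ.reg 16 = i ∧ ρ.reg 17 = j ∧
      ρ.out = τ.out ++ (List.range j).map (row i)) le_rfl ?_ ?_ ?_ ?_
    · exact ⟨by simpa, h2, by simpa, by simp, by simp⟩
    · rintro j ρ ⟨k1, -, -, k2, -⟩
      exact ⟨k1, k2⟩
    · rintro j hj ρ ⟨k1, k2, k3, k4, k5⟩
      refine .seq (.mul (va := i) (vb := N) (by norm_num) (by norm_num) (by norm_num) (by norm_num)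
        (by norm_num) k3 k1 hi.le (.print ?_))
      refine ⟨by simpa using k4, by simpa using k1, by simpa using k2, by simpa using k3, by simp,
        ?_⟩
      have := hE.matrix i hi j hj
      simp [Exp.eval, k5, k2, k4, List.range_succ, row, hN, this]
    · rintro ρ ⟨k1, k2, k3, -, k5⟩
      refine ⟨k3, by simpa using k1, by simpa using k2, by simp, ?_⟩
      simp only [Store.set_out, k5, h4, List.range_succ, List.flatMap_append,
        List.flatMap_singleton,
        List.cons_append]
  · rintro τ ⟨-, -, -, h⟩
    exact h

/-- The program that computes the reduction. -/
def Com.reduction : Com := .seq .dimensions (.seq .frameMarks (.seq .clauseMarks .output))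

theorem reduction_runsTo {cl : List (List (ℕ × ℕ × ℕ))} (hs : s = blockSize n)
    (hm : m = cl.length) (hlen : ∀ C ∈ cl, C.length ≤ 3) (hcl : ∀ C ∈ cl, ∀ l ∈ C, IsLit s l) :
    ∃ t ≤ Com.reduction.bound (graphOrder s m),
      RunsTo .reduction (n :: m :: clauseWord cl) t
        (graphWord (10 * s) (graphOrder s m) (frameLinks s ∪ clauseLinks s cl)) := by
  have hpos : 0 < s := by simp [hs, blockSize]
  obtain ⟨t, τ, h1, h2, h3⟩ : Ends (graphOrder s m) .reduction (initial (n :: m :: clauseWord cl))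
      fun τ => τ.out = graphWord (10 * s) (graphOrder s m) (frameLinks s ∪ clauseLinks s cl) := by
    refine .seq ((Ends.dimensions hs (by simp) (by simp)).mono fun τ₁ h₁ => .seq ?_)
    refine ((Adds.frameMarks hpos) ∅ h₁).mono fun τ₂ h₂ => .seq ?_
    refine (Ends.clauseMarks hpos hm hlen hcl h₂.1 rfl).mono fun τ₃ h₃ => ?_
    simpa using Ends.output h₃
  exact ⟨t, h2, τ, h1, h3⟩

end

end RAM

/-! ### Walks of given length -/

namespace SimpleGraph

variable {V : Type*} {G : SimpleGraph V} {u v w s t : V} {k l : ℕ}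

/-- There is a walk of length `k` from `u` to `v`. -/
def Steps (G : SimpleGraph V) (k : ℕ) (u v : V) : Prop := ∃ p : G.Walk u v, p.length = k

theorem Steps.refl (u : V) : G.Steps 0 u u := ⟨.nil, rfl⟩

theorem Steps.cons (h : G.Adj u v) (h' : G.Steps k v w) : G.Steps (k + 1) u w :=
  let ⟨p, hp⟩ := h'
  ⟨.cons h p, by simp [hp]⟩

theorem Steps.one (h : G.Adj u v) : G.Steps 1 u v := .cons h (.refl v)

theorem Steps.symm (h : G.Steps k u v) : G.Steps k v u :=
  let ⟨p, hp⟩ := h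
  ⟨p.reverse, by simp [hp]⟩

theorem Steps.trans (h : G.Steps k u v) (h' : G.Steps l v w) : G.Steps (k + l) u w :=
  let ⟨p, hp⟩ := h
  let ⟨q, hq⟩ := h'
  ⟨p.append q, by simp [hp, hq]⟩

theorem steps_zero : G.Steps 0 u v ↔ u = v :=
  ⟨fun ⟨p, hp⟩ => p.eq_of_length_eq_zero hp, fun h => h ▸ .refl u⟩

theorem steps_succ : G.Steps (k + 1) u v ↔ ∃ w, G.Adj u w ∧ G.Steps k w v := by
  refine ⟨fun ⟨p, hp⟩ => ?_, fun ⟨w, h, h'⟩ => .cons h h'⟩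
  cases p with
  | nil => simp at hp
  | cons h p => exact ⟨_, h, p, by simpa using hp⟩

/-- A potential that changes by at most one along each edge bounds distances from below. The
explicit potentials `level`, `depth` and `clauseDist` serve this purpose. -/
theorem Steps.le_add {f : V → ℕ} (hf : ∀ u v, G.Adj u v → f u ≤ f v + 1) (h : G.Steps k u v) :
    f u ≤ f v + k := by
  induction k generalizing u with
  | zero => rw [steps_zero.1 h]; omega
  | succ k ih =>
    obtain ⟨w, h1, h2⟩ := steps_succ.1 h
    have := ih h2
    have := hf u w h1
    omega

/-- A walk whose length is the distance is automatically a path, so only lengths of walks need to be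
compared from here on. -/
theorem onShortestPath_iff : G.OnShortestPath s t u ↔
    ∃ k l, G.Steps k s u ∧ G.Steps l u t ∧ ∀ j, G.Steps j s t → k + l ≤ j := by
  constructor
  · rintro ⟨p, -, hp, hu⟩
    classical
    refine ⟨_, _, ⟨p.takeUntil u hu, rfl⟩, ⟨p.dropUntil u hu, rfl⟩, ?_⟩
    rintro j ⟨q, rfl⟩
    have h1 := congrArg Walk.length (p.take_spec hu)
    rw [Walk.length_append] at h1
    have := dist_le q
    omega
  · rintro ⟨k, l, ⟨p, rfl⟩, ⟨q, rfl⟩, h⟩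
    have hd : (p.append q).length = G.dist s t := by
      refine le_antisymm ?_ (dist_le _)
      obtain ⟨r, hr⟩ := (p.append q).reachable.exists_walk_length_eq_dist
      rw [Walk.length_append, ← hr]
      exact h _ ⟨r, rfl⟩
    exact ⟨p.append q, Walk.isPath_of_length_eq_dist _ hd, hd, by simp⟩

theorem OnShortestPath.symm (h : G.OnShortestPath s t u) : G.OnShortestPath t s u := by
  obtain ⟨k, l, h1, h2, h3⟩ := onShortestPath_iff.1 h
  refine onShortestPath_iff.2 ⟨l, k, h2.symm, h1.symm, fun j hj => ?_⟩
  have := h3 j hj.symm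
  omega

/-- A leaf is in the interior of no shortest path. -/
theorem IsGeodeticSet.mem_of_leaf {S : Set V} (hS : G.IsGeodeticSet S)
    (h : ∀ v w, G.Adj u v → G.Adj u w → v = w) : u ∈ S := by
  obtain ⟨s, hs, t, ht, hu⟩ := hS u
  obtain ⟨k, l, h1, h2, h3⟩ := onShortestPath_iff.1 hu
  rcases k with - | k
  · rwa [← steps_zero.1 h1]
  rcases l with - | l
  · rwa [steps_zero.1 h2]
  exfalso
  obtain ⟨v, hv, h1⟩ := steps_succ.1 h1.symm
  obtain ⟨w, hw, h2⟩ := steps_succ.1 h2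
  obtain rfl := h v w hv hw
  have := h3 _ (h1.symm.trans h2)
  omega

end SimpleGraph

/-! ### The graph -/

/-- The vertices of the graph: `β` is the type of blocks, `α` of assignments of a block, `τ` of
values, `Γ` of clauses, and `π` indexes leaves at `z`. -/
inductive GadgetVertex (β α τ Γ π : Type) : Type
  | y | z | q
  | p (i : π)
  | v (b : β)
  | x (b : β)
  | b (b : β)
  | r (b : β)
  | g (b : β)
  | t (j : τ)
  | a (b : β) (f : α)
  | c (C : Γ)

/-- Which values an assignment of a block takes, and the blocks and the values that occur in a
clause. -/
structure ChoicePattern (β α τ Γ : Type) where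
  sat : β → α → τ → Prop
  inBlock : Γ → β → Prop
  inValue : Γ → τ → Prop

namespace ChoicePattern

variable {β α τ Γ π : Type} (D : ChoicePattern β α τ Γ)

/-- In `ax` the block's own `x` is left out. This puts `a b f` at distance 4 from `b b` but at
distance 3 from `b b'` for every other block b', so that only the pair inside one block can cover
clauses. -/
inductive Edge : GadgetVertex β α τ Γ π → GadgetVertex β α τ Γ π → Prop
  | yq : Edge .y .q
  | yv (b : β) : Edge .y (.v b)
  | yt (j : τ) : Edge .y (.t j)
  | zp (i : π) : Edge .z (.p i)
  | za (b : β) (f : α) : Edge .z (.a b f)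
  | vv (b b' : β) (h : b ≠ b') : Edge (.v b) (.v b')
  | vx (b : β) : Edge (.v b) (.x b)
  | vb (b : β) : Edge (.v b) (.b b)
  | vg (b : β) : Edge (.v b) (.g b)
  | rg (b : β) : Edge (.r b) (.g b)
  | ra (b : β) (f : α) : Edge (.r b) (.a b f)
  | ax (b b' : β) (f : α) (h : b ≠ b') : Edge (.a b f) (.x b')
  | aj (b : β) (f : α) (j : τ) (h : D.sat b f j) : Edge (.a b f) (.t j)
  | cv (C : Γ) (b : β) (h : D.inBlock C b) : Edge (.c C) (.v b)
  | ct (C : Γ) (j : τ) (h : D.inValue C j) : Edge (.c C) (.t j)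

variable (π) in
/-- The graph of the reduction. -/
def graph : SimpleGraph (GadgetVertex β α τ Γ π) where
  Adj u v := D.Edge u v ∨ D.Edge v u
  symm := ⟨fun _ _ h => h.symm⟩
  loopless := ⟨by rintro u (h | h) <;> cases h <;> contradiction⟩

variable {D}

theorem Edge.adj {u v : GadgetVertex β α τ Γ π} (h : D.Edge u v) : (D.graph π).Adj u v := .inl h

theorem Edge.adj' {u v : GadgetVertex β α τ Γ π} (h : D.Edge u v) : (D.graph π).Adj v u := .inr h

theorem lipschitz {f : GadgetVertex β α τ Γ π → ℕ}
    (hf : ∀ u v, D.Edge u v → f u ≤ f v + 1 ∧ f v ≤ f u + 1) (u v : GadgetVertex β α τ Γ π)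
    (h : (D.graph π).Adj u v) : f u ≤ f v + 1 := by
  rcases h with h | h
  · exact (hf u v h).1
  · exact (hf v u h).2

/-! #### A satisfying choice gives a geodetic set -/

/-- The distance from the leaves at `z`, roughly. -/
def level : GadgetVertex β α τ Γ π → ℕ
  | .p _ => 0
  | .z => 1
  | .a _ _ => 2
  | .t _ | .x _ | .r _ => 3
  | .y | .v _ | .g _ | .c _ => 4
  | .b _ | .q => 5

theorem level_le {u v : GadgetVertex β α τ Γ π} {k : ℕ} (h : (D.graph π).Steps k u v) :
    level u ≤ level v + k :=
  h.le_add (lipschitz (by rintro u v h; cases h <;> simp [level]))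

open Classical in
/-- The distance from the leaf at `v b`, roughly. -/
noncomputable def depth (b₀ : β) : GadgetVertex β α τ Γ π → ℕ
  | .b b => if b = b₀ then 0 else 2
  | .v b => if b = b₀ then 1 else 2
  | .x b => if b = b₀ then 2 else 3
  | .g b => if b = b₀ then 2 else 3
  | .a b _ => if b = b₀ then 4 else 3
  | .y | .q | .c _ => 2
  | .t _ | .r _ | .z | .p _ => 3

theorem depth_le (b₀ : β) {u v : GadgetVertex β α τ Γ π} {k : ℕ} (h : (D.graph π).Steps k u v) :
    depth b₀ u ≤ depth b₀ v + k := by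
  refine h.le_add (lipschitz ?_)
  rintro u v h
  cases h <;> simp only [depth] <;> (try split_ifs) <;> simp_all

theorem covered_of_steps {S : Set (GadgetVertex β α τ Γ π)} {s t u : GadgetVertex β α τ Γ π}
    {k l n : ℕ} (hs : s ∈ S) (ht : t ∈ S)
    (h : (D.graph π).Steps k s u) (h' : (D.graph π).Steps l u t) (hn : k + l = n)
    (hd : ∀ j, (D.graph π).Steps j s t → n ≤ j) :
    ∃ s₁ ∈ S, ∃ s₂ ∈ S, (D.graph π).OnShortestPath s₁ s₂ u :=
  ⟨s, hs, t, ht, SimpleGraph.onShortestPath_iff.2 ⟨k, l, h, h', fun j hj => hn ▸ hd j hj⟩⟩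

open SimpleGraph (Steps)

/-- The shortest paths in use are p–z–a–t–y–q and p–z–a–x–v–b of length 5, where the `a` in the
second belongs to another block, and a–r–g–v–b and a–t–c–v–b of length 4. The first two are shortest
by `level`, the last two by `depth`. Only the last one depends on the choice f being satisfying. -/
theorem isGeodeticSet_of_choice [Nonempty π] [Nontrivial β] [Nonempty α] (f : β → α)
    {S : Set (GadgetVertex β α τ Γ π)}
    (hp : ∀ i, .p i ∈ S) (hq : .q ∈ S) (hb : ∀ b, .b b ∈ S) (ha : ∀ b, .a b (f b) ∈ S)
    (hat : ∀ b f, ∃ j, D.sat b f j) (hta : ∀ j, ∃ b f, D.sat b f j)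
    (hC : ∀ C, ∃ b, D.inBlock C b ∧ ∃ j, D.inValue C j ∧ D.sat b (f b) j) :
    (D.graph π).IsGeodeticSet S := by
  obtain ⟨i₀⟩ := ‹Nonempty π›
  obtain ⟨f₀⟩ := ‹Nonempty α›
  have far (i : π) (b : β) (j : ℕ) (h : (D.graph π).Steps j (.p i) (.b b)) : 5 ≤ j := by
    simpa [level] using level_le h.symm
  have far' (i : π) (j : ℕ) (h : (D.graph π).Steps j (.p i) .q) : 5 ≤ j := by
    simpa [level] using level_le h.symm
  have far'' (b : β) (f : α) (j : ℕ) (h : (D.graph π).Steps j (.a b f) (.b b)) : 4 ≤ j := by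
    simpa [depth] using depth_le b h
  have pa (i : π) (b : β) (f : α) : (D.graph π).Steps 2 (.p i) (.a b f) :=
    .cons (Edge.zp i).adj' (.one (Edge.za b f).adj)
  have xb (b : β) : (D.graph π).Steps 2 (.x b) (.b b) :=
    .cons (Edge.vx b).adj' (.one (Edge.vb b).adj)
  have tq (j : τ) : (D.graph π).Steps 2 (.t j) .q := .cons (Edge.yt j).adj' (.one Edge.yq.adj)
  intro u
  cases u with
  | y =>
    obtain ⟨b⟩ := (inferInstance : Nonempty β)
    obtain ⟨j, hj⟩ := hat b f₀
    exact covered_of_steps (hp i₀) hq (((pa i₀ b f₀).trans (.one (Edge.aj _ _ _ hj).adj)).trans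
      (.one (Edge.yt j).adj')) (.one Edge.yq.adj) rfl (far' i₀)
  | q => exact covered_of_steps hq hq (.refl _) (.refl _) rfl (by simp)
  | p i => exact covered_of_steps (hp i) (hp i) (.refl _) (.refl _) rfl (by simp)
  | b b => exact covered_of_steps (hb b) (hb b) (.refl _) (.refl _) rfl (by simp)
  | z =>
    obtain ⟨b⟩ := (inferInstance : Nonempty β)
    obtain ⟨j, hj⟩ := hat b f₀
    exact covered_of_steps (hp i₀) hq (.one (Edge.zp i₀).adj') (.cons (Edge.za b f₀).adj
      (.cons (Edge.aj _ _ _ hj).adj (tq j))) rfl (far' i₀)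
  | a b f =>
    obtain ⟨j, hj⟩ := hat b f
    exact covered_of_steps (hp i₀) hq (pa i₀ b f) (.cons (Edge.aj _ _ _ hj).adj (tq j)) rfl
      (far' i₀)
  | t j =>
    obtain ⟨b, f, hj⟩ := hta j
    exact covered_of_steps (hp i₀) hq ((pa i₀ b f).trans (.one (Edge.aj _ _ _ hj).adj)) (tq j) rfl
      (far' i₀)
  | x b =>
    obtain ⟨b', hb'⟩ := exists_ne b
    exact covered_of_steps (hp i₀) (hb b) ((pa i₀ b' f₀).trans (.one (Edge.ax _ _ _ hb').adj))
      (xb b) rfl (far i₀ b)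
  | v b =>
    obtain ⟨b', hb'⟩ := exists_ne b
    exact covered_of_steps (hp i₀) (hb b) (((pa i₀ b' f₀).trans (.one
      (Edge.ax _ _ _ hb').adj)).trans (.one (Edge.vx b).adj')) (.one (Edge.vb b).adj) rfl (far i₀ b)
  | r b =>
    exact covered_of_steps (ha b) (hb b) (.one (Edge.ra b _).adj') (.cons (Edge.rg b).adj
      (.cons (Edge.vg b).adj' (.one (Edge.vb b).adj))) rfl (far'' b _)
  | g b =>
    exact covered_of_steps (ha b) (hb b) (.cons (Edge.ra b _).adj' (.one (Edge.rg b).adj))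
      (.cons (Edge.vg b).adj' (.one (Edge.vb b).adj)) rfl (far'' b _)
  | c C =>
    obtain ⟨b, h1, j, h2, h3⟩ := hC C
    exact covered_of_steps (ha b) (hb b) (.cons (Edge.aj _ _ _ h3).adj (.one (Edge.ct C j h2).adj'))
      (.cons (Edge.cv C b h1).adj (.one (Edge.vb b).adj)) rfl (far'' b _)

/-! #### A geodetic set gives a satisfying choice -/

/-- The vertices that belong to the block `b` alone. -/
def IsLocal (b : β) : GadgetVertex β α τ Γ π → Prop
  | .a b' _ => b' = b
  | .r b' => b' = b
  | .g b' => b' = b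
  | _ => False

/-- A walk to `g b` from outside must enter the local vertices of the block. If it enters at `g b`
it comes from `v b`; if it enters at some `a b f`, there is a detour to `v b` that is no longer. It
cannot enter at `r b`, whose neighbours are all local. -/
theorem steps_v_of_steps_g [Nontrivial β] {b : β} {u : GadgetVertex β α τ Γ π} {k : ℕ}
    (hu : ¬ IsLocal b u) (h : (D.graph π).Steps k u (.g b)) :
    ∃ j ≤ k, (D.graph π).Steps j u (.v b) := by
  induction k generalizing u with
  | zero => rw [SimpleGraph.steps_zero.1 h] at hu; simp [IsLocal] at hu
  | succ k ih =>
    obtain ⟨w, h1, h2⟩ := SimpleGraph.steps_succ.1 h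
    by_cases hw : IsLocal b w
    · cases w with
      | g b' =>
        obtain rfl : b' = b := hw
        rcases h1 with h1 | h1
        · cases h1 with
          | vg => exact ⟨0, by omega, .refl _⟩
          | rg => simp [IsLocal] at hu
        · cases h1
      | r b' =>
        obtain rfl : b' = b := hw
        rcases h1 with h1 | h1
        · cases h1
        · cases h1 <;> simp [IsLocal] at hu
      | a b' f =>
        obtain rfl : b' = b := hw
        -- From `a` to `g` takes at least two steps, so the walk has length at least 3. Its start is
        -- `z`, an `x` of another block or a `t`, and each of these reaches `v` in at most 3 steps.
        have hk : 2 ≤ k := by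
          rcases k with - | - | k
          · simpa using SimpleGraph.steps_zero.1 h2
          · obtain ⟨w, h3, h4⟩ := SimpleGraph.steps_succ.1 h2
            rw [SimpleGraph.steps_zero.1 h4] at h3
            rcases h3 with h3 | h3 <;> cases h3
          · omega
        obtain ⟨b'', hb''⟩ := exists_ne b'
        rcases h1 with h1 | h1
        · cases h1 with
          | za => exact ⟨3, by omega, .cons (Edge.za b'' f).adj (.cons (Edge.ax _ _ _ hb'').adj
              (.one (Edge.vx b').adj'))⟩
          | ra => simp [IsLocal] at hu
        · cases h1 with
          | ax _ b₁ _ hne =>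
            exact ⟨2, by omega, .cons (Edge.vx b₁).adj' (.one (Edge.vv _ _ hne).adj')⟩
          | aj _ _ j => exact ⟨2, by omega, .cons (Edge.yt j).adj' (.one (Edge.yv _).adj)⟩
      | _ => simp [IsLocal] at hw
    · obtain ⟨j, hj, h3⟩ := ih hw h2
      exact ⟨j + 1, by omega, .cons h1 h3⟩

/-- By `steps_v_of_steps_g`, a vertex outside the block is no farther from `v b` than from `g b`, so
a path between two such vertices gains nothing by visiting `g b`. -/
theorem exists_local_mem [Nontrivial β] {S : Set (GadgetVertex β α τ Γ π)}
    (hS : (D.graph π).IsGeodeticSet S) (b : β) : ∃ u ∈ S, IsLocal b u := by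
  by_contra! hno
  obtain ⟨s, hs, t, ht, hu⟩ := hS (.g b)
  obtain ⟨k, l, h1, h2, h3⟩ := SimpleGraph.onShortestPath_iff.1 hu
  obtain ⟨i, hi, hsv⟩ := steps_v_of_steps_g (hno s hs) h1
  obtain ⟨j, hj, htv⟩ := steps_v_of_steps_g (hno t ht) h2.symm
  rcases k with - | k
  · exact hno s hs (SimpleGraph.steps_zero.1 h1 ▸ rfl)
  rcases l with - | l
  · exact hno t ht (SimpleGraph.steps_zero.1 h2 ▸ rfl)
  have nbr (w : GadgetVertex β α τ Γ π) (h : (D.graph π).Adj (.g b) w) : w = .v b ∨ w = .r b := by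
    rcases h with h | h <;> cases h <;> simp
  obtain ⟨w, hw, h1'⟩ := SimpleGraph.steps_succ.1 h1.symm
  obtain ⟨w', hw', h2'⟩ := SimpleGraph.steps_succ.1 h2
  -- If the path through `g b` uses `v b` on one side, going directly to `v b` from the other end is
  -- shorter; if it uses `r b` on both sides, `g b` can be skipped.
  rcases nbr w hw with rfl | rfl
  · have := h3 _ (h1'.symm.trans htv.symm)
    omega
  rcases nbr w' hw' with rfl | rfl
  · have := h3 _ (hsv.trans h2')
    omega
  · have := h3 _ (h1'.symm.trans h2')
    omega

/-- The vertices that may belong to a geodetic set of minimum size. -/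
def IsCandidate : GadgetVertex β α τ Γ π → Prop
  | .p _ | .q | .b _ | .a _ _ | .r _ | .g _ => True
  | _ => False

open Classical in
/-- A lower bound of the distance from the clause `C`. -/
noncomputable def clauseDist (C : Γ) : GadgetVertex β α τ Γ π → ℕ
  | .p _ => 4
  | .q | .r _ | .z => 3
  | .t _ | .v _ => 1
  | .x _ | .y | .a _ _ | .g _ | .b _ => 2
  | .c C' => if C' = C then 0 else 2

theorem clauseDist_le {C : Γ} {u : GadgetVertex β α τ Γ π} {k : ℕ}
    (h : (D.graph π).Steps k u (.c C)) : clauseDist C u ≤ k := by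
  have h1 := h.le_add (f := clauseDist C) (lipschitz ?_)
  · simpa [clauseDist] using h1
  · rintro u v h
    cases h <;> simp only [clauseDist] <;> (try split_ifs) <;> simp_all

/-- The distance of `s` and `t` is too small for a shortest path through the clause `C`. -/
def Close (D : ChoicePattern β α τ Γ) (C : Γ) (s t : GadgetVertex β α τ Γ π) : Prop :=
  ∃ j < clauseDist C s + clauseDist C t, (D.graph π).Steps j s t

theorem Close.symm {C : Γ} {s t : GadgetVertex β α τ Γ π} (h : D.Close C s t) : D.Close C t s := by
  obtain ⟨j, hj, h⟩ := h
  exact ⟨j, by omega, h.symm⟩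

/-- Short connections run through the hubs `z` and `y`, through the clique of the `v`, or inside the
block. Inspection of all pairs leaves one exception, `a b f` with `b b`, whose distance 4 equals the
sum 2 + 2 of the bounds to the clause. -/
theorem close_or_eq [Nontrivial β] [Nonempty α] (hat : ∀ b f, ∃ j, D.sat b f j) (C : Γ)
    {s t : GadgetVertex β α τ Γ π} (hs : IsCandidate s) (ht : IsCandidate t) :
    D.Close C s t ∨ ∃ b f, (s = .a b f ∧ t = .b b) ∨ (s = .b b ∧ t = .a b f) := by
  obtain ⟨b₀⟩ := (inferInstance : Nonempty β)
  obtain ⟨f₀⟩ := ‹Nonempty α›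
  have ay (b : β) (f : α) : (D.graph π).Steps 2 (.a b f) .y := by
    obtain ⟨j, hj⟩ := hat b f
    exact .cons (Edge.aj _ _ _ hj).adj (.one (Edge.yt j).adj')
  have az (b : β) (f : α) : (D.graph π).Steps 1 (.a b f) .z := .one (Edge.za b f).adj'
  have rz (b : β) : (D.graph π).Steps 2 (.r b) .z := .cons (Edge.ra b f₀).adj (az b f₀)
  have gz (b : β) : (D.graph π).Steps 3 (.g b) .z := .cons (Edge.rg b).adj' (rz b)
  have bv (b : β) : (D.graph π).Steps 1 (.b b) (.v b) := .one (Edge.vb b).adj'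
  have gv (b : β) : (D.graph π).Steps 1 (.g b) (.v b) := .one (Edge.vg b).adj'
  have av (b b' : β) (f : α) (h : b ≠ b') : (D.graph π).Steps 2 (.a b f) (.v b') :=
    .cons (Edge.ax _ _ _ h).adj (.one (Edge.vx b').adj')
  have rv (b b' : β) (h : b ≠ b') : (D.graph π).Steps 3 (.r b) (.v b') :=
    .cons (Edge.ra b f₀).adj (av b b' f₀ h)
  have vz (b : β) : (D.graph π).Steps 3 (.v b) .z := by
    obtain ⟨b', hb'⟩ := exists_ne b
    exact ((av b' b f₀ hb').symm.trans (az b' f₀))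
  have qz : (D.graph π).Steps 4 .q .z :=
    (Steps.one Edge.yq.adj').trans ((ay b₀ f₀).symm.trans (az b₀ f₀))
  have vv (b b' : β) : ∃ j ≤ 1, (D.graph π).Steps j (.v b) (.v b') := by
    by_cases h : b = b'
    · exact ⟨0, by omega, h ▸ .refl _⟩
    · exact ⟨1, le_rfl, .one (Edge.vv _ _ h).adj⟩
  have vy (b : β) : (D.graph π).Steps 1 (.v b) .y := .one (Edge.yv b).adj'
  have pClose (i : π) (t : GadgetVertex β α τ Γ π) (ht : IsCandidate t) : D.Close C (.p i) t := by
    have pz : (D.graph π).Steps 1 (.p i) .z := .one (Edge.zp i).adj'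
    cases t with
    | p i' => exact ⟨_, by simp [clauseDist], pz.trans (.one (Edge.zp i').adj)⟩
    | q => exact ⟨_, by simp [clauseDist], pz.trans qz.symm⟩
    | b b => exact ⟨_, by simp [clauseDist], pz.trans ((bv b).trans (vz b)).symm⟩
    | a b f => exact ⟨_, by simp [clauseDist], pz.trans (az b f).symm⟩
    | r b => exact ⟨_, by simp [clauseDist], pz.trans (rz b).symm⟩
    | g b => exact ⟨_, by simp [clauseDist], pz.trans (gz b).symm⟩
    | _ => exact ht.elim
  have qClose (t : GadgetVertex β α τ Γ π) (ht : IsCandidate t) : D.Close C .q t := by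
    have qy : (D.graph π).Steps 1 .q .y := .one Edge.yq.adj'
    cases t with
    | p i => exact (pClose i .q trivial).symm
    | q => exact ⟨0, by simp [clauseDist], .refl _⟩
    | b b => exact ⟨_, by simp [clauseDist], qy.trans ((bv b).trans (vy b)).symm⟩
    | a b f => exact ⟨_, by simp [clauseDist], qy.trans (ay b f).symm⟩
    | r b => exact ⟨_, by simp [clauseDist], qy.trans
        (Steps.cons (Edge.rg b).adj ((gv b).trans (vy b))).symm⟩
    | g b => exact ⟨_, by simp [clauseDist], qy.trans ((gv b).trans (vy b)).symm⟩
    | _ => exact ht.elim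
  have bb (b b' : β) : D.Close C (.b b : GadgetVertex β α τ Γ π) (.b b') := by
    obtain ⟨j, hj, h⟩ := vv b b'
    exact ⟨_, by simp [clauseDist]; omega, (bv b).trans (h.trans (bv b').symm)⟩
  have bg (b b' : β) : D.Close C (.b b : GadgetVertex β α τ Γ π) (.g b') := by
    obtain ⟨j, hj, h⟩ := vv b b'
    exact ⟨_, by simp [clauseDist]; omega, (bv b).trans (h.trans (gv b').symm)⟩
  have gg (b b' : β) : D.Close C (.g b : GadgetVertex β α τ Γ π) (.g b') := by
    obtain ⟨j, hj, h⟩ := vv b b'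
    exact ⟨_, by simp [clauseDist]; omega, (gv b).trans (h.trans (gv b').symm)⟩
  have rb (b b' : β) : D.Close C (.r b : GadgetVertex β α τ Γ π) (.b b') := by
    by_cases h : b = b'
    · subst h
      exact ⟨_, by simp [clauseDist], (Steps.cons (Edge.rg b).adj (gv b)).trans (bv b).symm⟩
    · exact ⟨_, by simp [clauseDist], (rv b b' h).trans (bv b').symm⟩
  have rg (b b' : β) : D.Close C (.r b : GadgetVertex β α τ Γ π) (.g b') := by
    by_cases h : b = b'
    · subst h
      exact ⟨_, by simp [clauseDist], .one (Edge.rg b).adj⟩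
    · exact ⟨_, by simp [clauseDist], (rv b b' h).trans (gv b').symm⟩
  have rr (b b' : β) : D.Close C (.r b : GadgetVertex β α τ Γ π) (.r b') :=
    ⟨_, by simp [clauseDist], (rz b).trans (rz b').symm⟩
  have ra (b b' : β) (f : α) : D.Close C (.r b : GadgetVertex β α τ Γ π) (.a b' f) :=
    ⟨_, by simp [clauseDist], (rz b).trans (az b' f).symm⟩
  have aa (b b' : β) (f f' : α) : D.Close C (.a b f : GadgetVertex β α τ Γ π) (.a b' f') :=
    ⟨_, by simp [clauseDist], (az b f).trans (az b' f').symm⟩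
  have ag (b b' : β) (f : α) : D.Close C (.a b f : GadgetVertex β α τ Γ π) (.g b') := by
    by_cases h : b = b'
    · subst h
      exact ⟨_, by simp [clauseDist], .cons (Edge.ra b f).adj' (.one (Edge.rg b).adj)⟩
    · exact ⟨_, by simp [clauseDist], (av b b' f h).trans (gv b').symm⟩
  have ab (b b' : β) (f : α) (h : b ≠ b') :
      D.Close C (.a b f : GadgetVertex β α τ Γ π) (.b b') :=
    ⟨_, by simp [clauseDist], (av b b' f h).trans (bv b').symm⟩
  cases s with
  | p i => exact .inl (pClose i t ht)
  | q => exact .inl (qClose t ht)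
  | b b =>
    cases t with
    | p i => exact .inl (pClose i _ hs).symm
    | q => exact .inl (qClose _ hs).symm
    | b b' => exact .inl (bb b b')
    | a b' f =>
      by_cases h : b' = b
      · subst h; exact .inr ⟨b', f, by simp⟩
      · exact .inl (ab b' b f h).symm
    | r b' => exact .inl (rb b' b).symm
    | g b' => exact .inl (bg b b')
    | _ => exact ht.elim
  | a b f =>
    cases t with
    | p i => exact .inl (pClose i _ hs).symm
    | q => exact .inl (qClose _ hs).symm
    | b b' =>
      by_cases h : b = b'
      · subst h; exact .inr ⟨b, f, by simp⟩
      · exact .inl (ab b b' f h)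
    | a b' f' => exact .inl (aa b b' f f')
    | r b' => exact .inl (ra b' b f).symm
    | g b' => exact .inl (ag b b' f)
    | _ => exact ht.elim
  | r b =>
    cases t with
    | p i => exact .inl (pClose i _ hs).symm
    | q => exact .inl (qClose _ hs).symm
    | b b' => exact .inl (rb b b')
    | a b' f' => exact .inl (ra b b' f')
    | r b' => exact .inl (rr b b')
    | g b' => exact .inl (rg b b')
    | _ => exact ht.elim
  | g b =>
    cases t with
    | p i => exact .inl (pClose i _ hs).symm
    | q => exact .inl (qClose _ hs).symm
    | b b' => exact .inl (bg b' b).symm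
    | a b' f' => exact .inl (ag b' b f').symm
    | r b' => exact .inl (rg b' b).symm
    | g b' => exact .inl (gg b b')
    | _ => exact ht.elim
  | _ => exact hs.elim

theorem satisfied_of_covered {C : Γ} {b : β} {f : α}
    (h : (D.graph π).OnShortestPath (.a b f) (.b b) (.c C)) :
    D.inBlock C b ∧ ∃ j, D.inValue C j ∧ D.sat b f j := by
  obtain ⟨k, l, h1, h2, h3⟩ := SimpleGraph.onShortestPath_iff.1 h
  have hk : 2 ≤ k := clauseDist_le h1
  have hl : 2 ≤ l := clauseDist_le h2.symm
  -- The path a–r–g–v–b limits the length to 4, so the clause lies exactly in the middle.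
  have h4 := h3 _ (.cons (Edge.ra b f).adj' (.cons (Edge.rg b).adj (.cons (Edge.vg b).adj'
    (.one (Edge.vb b).adj))))
  obtain rfl : k = 2 := by omega
  obtain rfl : l = 2 := by omega
  obtain ⟨u, hu, h1⟩ := SimpleGraph.steps_succ.1 h1
  obtain ⟨u', hu', h1⟩ := SimpleGraph.steps_succ.1 h1
  rw [SimpleGraph.steps_zero.1 h1] at hu'
  obtain ⟨w, hw, h2⟩ := SimpleGraph.steps_succ.1 h2
  obtain ⟨w', hw', h2⟩ := SimpleGraph.steps_succ.1 h2
  rw [SimpleGraph.steps_zero.1 h2] at hw'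
  constructor
  · rcases hw' with hw' | hw'
    · cases hw'
      rcases hw with hw | hw
      · cases hw; assumption
      · cases hw
    · cases hw'
  · rcases hu' with hu' | hu'
    · cases hu'
    · cases hu' with
      | cv => rcases hu with hu | hu <;> cases hu
      | ct _ j hj =>
        rcases hu with hu | hu
        · cases hu; exact ⟨j, hj, by assumption⟩
        · cases hu

/-- The leaves and one local vertex for each block are pairwise distinct and already exhaust the
budget, so they make up all of S. In particular no block has two local vertices in S. -/
theorem exists_choice [Fintype β] [Fintype π] [Nonempty α]
    {S : Finset (GadgetVertex β α τ Γ π)} (hcard : S.card ≤ 1 + Fintype.card π + 2 * Fintype.card β)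
    (hp : ∀ i, .p i ∈ S) (hq : .q ∈ S) (hb : ∀ b, .b b ∈ S) (hloc : ∀ b, ∃ u ∈ S, IsLocal b u) :
    (∀ u ∈ S, IsCandidate u) ∧ ∃ f : β → α, ∀ b g, .a b g ∈ S → g = f b := by
  classical
  choose h hS hh using hloc
  let ι : (Unit ⊕ π) ⊕ (β ⊕ β) → GadgetVertex β α τ Γ π :=
    Sum.elim (Sum.elim (fun _ => .q) .p) (Sum.elim .b h)
  have hinj : Function.Injective ι := by
    rintro ((⟨⟩ | i) | (b | b)) ((⟨⟩ | i') | (b' | b')) e <;>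
      simp only [ι, Sum.elim_inl, Sum.elim_inr] at e <;> try simp_all <;> done
    all_goals first
      | (have := hh b'; rw [← e] at this; simp [IsLocal] at this; done)
      | (have := hh b; rw [e] at this; simp [IsLocal] at this; done)
      | skip
    have h1 := hh b
    have h2 := hh b'
    rw [← e] at h2
    generalize h b = u at h1 h2
    cases u <;> simp_all [IsLocal]
  have himg : Finset.univ.image ι = S := by
    refine Finset.eq_of_subset_of_card_le (fun u hu => ?_) ?_
    · obtain ⟨((⟨⟩ | i) | (b | b)), -, rfl⟩ := Finset.mem_image.1 hu
      exacts [hq, hp i, hb b, hS b]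
    · rw [Finset.card_image_of_injective _ hinj]
      simp only [Finset.card_univ, Fintype.card_sum, Fintype.card_unit]
      omega
  constructor
  · intro u hu
    rw [← himg] at hu
    obtain ⟨((⟨⟩ | i) | (b | b)), -, rfl⟩ := Finset.mem_image.1 hu
    · trivial
    · trivial
    · trivial
    · have := hh b
      change IsCandidate (h b)
      generalize h b = u at this
      cases u <;> trivial
  · have key : ∀ b g, .a b g ∈ S → h b = .a b g := by
      intro b g hu
      rw [← himg] at hu
      obtain ⟨((⟨⟩ | i) | (b' | b')), -, e⟩ := Finset.mem_image.1 hu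
      · simp [ι] at e
      · simp [ι] at e
      · simp [ι] at e
      · simp only [ι, Sum.elim_inr] at e
        have h1 := hh b'
        rw [e] at h1
        obtain rfl : b = b' := h1
        exact e
    -- A block represented by `r` or `g` may receive any assignment, since no vertex `a b g` of it
    -- lies in S.
    refine ⟨fun b => match h b with
      | .a _ g => g
      | _ => Classical.arbitrary α, fun b g hg => ?_⟩
    simp only [key b g hg]

/-- One can choose an assignment for every block such that all clauses are satisfied. -/
def Satisfiable (D : ChoicePattern β α τ Γ) : Prop :=
  ∃ f : β → α, ∀ C, ∃ b, D.inBlock C b ∧ ∃ j, D.inValue C j ∧ D.sat b (f b) j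

/-- The graph has a geodetic set of the given size if and only if the pattern is
satisfiable. -/
theorem exists_isGeodeticSet_iff [Fintype β] [Fintype π] [Nonempty π] [Nontrivial β] [Nonempty α]
    (hat : ∀ b f, ∃ j, D.sat b f j) (hta : ∀ j, ∃ b f, D.sat b f j) :
    (∃ S : Finset (GadgetVertex β α τ Γ π), S.card ≤ 1 + Fintype.card π + 2 * Fintype.card β ∧
      (D.graph π).IsGeodeticSet (S : Set (GadgetVertex β α τ Γ π))) ↔
    D.Satisfiable := by
  classical
  constructor
  · rintro ⟨S, hcard, hS⟩
    have leaf (u w : GadgetVertex β α τ Γ π) (h : ∀ v, (D.graph π).Adj u v → v = w) : u ∈ S :=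
      Finset.mem_coe.1 (hS.mem_of_leaf fun v v' hv hv' => (h v hv).trans (h v' hv').symm)
    obtain ⟨hcand, f, hf⟩ := exists_choice hcard
      (fun i => leaf (.p i) .z (by rintro v (h | h) <;> cases h; rfl))
      (leaf .q .y (by rintro v (h | h) <;> cases h; rfl))
      (fun b => leaf (.b b) (.v b) (by rintro v (h | h) <;> cases h; rfl))
      (exists_local_mem hS)
    refine ⟨f, fun C => ?_⟩
    obtain ⟨s, hs, t, ht, hC⟩ := hS (.c C)
    rcases close_or_eq hat C (hcand s hs) (hcand t ht) with
      ⟨j, hj, hst⟩ | ⟨b, g, ⟨rfl, rfl⟩ | ⟨rfl, rfl⟩⟩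
    · obtain ⟨k, l, h1, h2, h3⟩ := SimpleGraph.onShortestPath_iff.1 hC
      have := clauseDist_le h1
      have := clauseDist_le h2.symm
      have := h3 j hst
      omega
    · obtain rfl := hf b g hs
      exact ⟨b, satisfied_of_covered hC⟩
    · obtain rfl := hf b g ht
      exact ⟨b, satisfied_of_covered hC.symm⟩
  · rintro ⟨f, hf⟩
    refine ⟨insert .q (Finset.univ.image .p ∪ (Finset.univ.image .b ∪
      Finset.univ.image fun b => .a b (f b))), ?_, ?_⟩
    · refine (Finset.card_insert_le _ _).trans ?_
      have h1 := Finset.card_union_le (Finset.univ.image (.p : π → GadgetVertex β α τ Γ π))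
        (Finset.univ.image .b ∪ Finset.univ.image fun b => .a b (f b))
      have h2 := Finset.card_union_le (Finset.univ.image (.b : β → GadgetVertex β α τ Γ π))
        (Finset.univ.image fun b => .a b (f b))
      have h3 := Finset.card_image_le (s := Finset.univ) (f := (.p : π → GadgetVertex β α τ Γ π))
      have h4 := Finset.card_image_le (s := Finset.univ) (f := (.b : β → GadgetVertex β α τ Γ π))
      have h5 := Finset.card_image_le (s := Finset.univ)
        (f := (fun b => .a b (f b) : β → GadgetVertex β α τ Γ π))
      rw [Finset.card_univ] at h3 h4 h5
      omega
    · exact isGeodeticSet_of_choice f (by simp) (by simp) (by simp) (by simp) hat hta hf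

/-- The vertices of a small vertex cover. -/
def InCover : GadgetVertex β α τ Γ π → Prop
  | .y | .z | .v _ | .x _ | .r _ | .t _ => True
  | _ => False

theorem inCover_or_inCover {u v : GadgetVertex β α τ Γ π} (h : (D.graph π).Adj u v) :
    InCover u ∨ InCover v := by
  rcases h with h | h <;> cases h <;> simp [InCover]

end ChoicePattern

namespace RAM

/-! ### The numbering of the vertices -/

/-- The blocks, assignments and values of an instance with `3 s` blocks of `s` variables and the
clauses `cl`. -/
def pattern (s : ℕ) (cl : List (List (ℕ × ℕ × ℕ))) :
    ChoicePattern (Fin (3 * s)) (Fin (2 ^ s)) (Fin (6 * s)) (Fin cl.length) where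
  sat b f j := ∃ i < s, (j : ℕ) = b / s * (2 * s) + (i + i + f / 2 ^ i % 2)
  inBlock C b := ∃ l ∈ cl.getD C [], (b : ℕ) = l.1 * s + l.2.1 / s
  inValue C j := ∃ l ∈ cl.getD C [], (j : ℕ) = l.1 * (2 * s) + (l.2.1 % s + l.2.1 % s + l.2.2)

/-- The vertices of the constructed graph. -/
abbrev PatternVertex (s m : ℕ) : Type :=
  GadgetVertex (Fin (3 * s)) (Fin (2 ^ s)) (Fin (6 * s)) (Fin m) (Fin (4 * s - 1))

variable {s m : ℕ}

def number : PatternVertex s m → ℕ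
  | .y => 0
  | .z => 1
  | .q => 2
  | .p i => 3 + i
  | .v b => 4 * s + 2 + b
  | .x b => 7 * s + 2 + b
  | .b b => 10 * s + 2 + b
  | .r b => 13 * s + 2 + b
  | .g b => 16 * s + 2 + b
  | .t j => 19 * s + 2 + j
  | .a b f => assignmentVertex s b f
  | .c C => clauseVertex s C

/-- The position of the kind of a vertex in the numbering. -/
def kind : PatternVertex s m → ℕ
  | .y => 0
  | .z => 1
  | .q => 2
  | .p _ => 3
  | .v _ => 4
  | .x _ => 5
  | .b _ => 6
  | .r _ => 7
  | .g _ => 8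
  | .t _ => 9
  | .a _ _ => 10
  | .c _ => 11

/-- The least number of a vertex of given kind. -/
def offset (s m : ℕ) : ℕ → ℕ
  | 0 => 0
  | 1 => 1
  | 2 => 2
  | 3 => 3
  | 4 => 4 * s + 2
  | 5 => 7 * s + 2
  | 6 => 10 * s + 2
  | 7 => 13 * s + 2
  | 8 => 16 * s + 2
  | 9 => 19 * s + 2
  | 10 => 25 * s + 2
  | 11 => 25 * s + 2 + 3 * s * 2 ^ s
  | _ => graphOrder s m

theorem offset_mono (hs : 0 < s) : Monotone (offset s m) := by
  refine monotone_nat_of_le_succ fun n => ?_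
  match n with
  | 0 | 1 | 2 | 3 | 4 | 5 | 6 | 7 | 8 | 9 | 10 | 11 =>
    simp only [offset, graphOrder, Nat.reduceAdd]; omega
  | n + 12 => exact le_rfl

theorem offset_le_number (u : PatternVertex s m) :
    offset s m (kind u) ≤ number u ∧ number u < offset s m (kind u + 1) := by
  cases u with
  | a b f =>
    have := index_lt b.2 f.2
    simp only [number, kind, offset, assignmentVertex]
    omega
  | _ => simp only [number, kind, offset, clauseVertex, graphOrder]; omega

theorem number_lt (hs : 0 < s) (u : PatternVertex s m) : number u < graphOrder s m := by
  refine (offset_le_number u).2.trans_le (offset_mono hs (b := 12) ?_)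
  cases u <;> simp [kind]

/-- The kinds occupy disjoint consecutive intervals, so equal numbers have equal kinds; within one
kind only the pairs (block, assignment) need division with remainder. -/
theorem number_injective (hs : 0 < s) : Function.Injective (number (s := s) (m := m)) := by
  intro u v h
  have hu := offset_le_number u
  have hv := offset_le_number v
  have hk : kind u = kind v := by
    rcases lt_trichotomy (kind u) (kind v) with hk | hk | hk
    · have := offset_mono (m := m) hs (Nat.succ_le_of_lt hk)
      simp only [Nat.succ_eq_add_one] at this
      omega
    · exact hk
    · have := offset_mono (m := m) hs (Nat.succ_le_of_lt hk)
      simp only [Nat.succ_eq_add_one] at this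
      omega
  clear hu hv
  cases u <;> cases v <;>
    simp only [kind, zero_ne_one, one_ne_zero, Nat.reduceEqDiff] at hk
  case a.a b f b' f' =>
    simp only [number, assignmentVertex, Nat.add_left_cancel_iff, mul_add_inj f.2 f'.2] at h
    rw [Fin.ext h.1, Fin.ext h.2]
  all_goals
    simp only [number, clauseVertex, Nat.add_left_cancel_iff] at h
    first
    | rfl
    | rw [Fin.ext h]

theorem exists_number_eq (n : ℕ) (hn : n < graphOrder s m) :
    ∃ u : PatternVertex s m, number u = n := by
  have block {k : ℕ} (o : ℕ) (f : Fin k → PatternVertex s m) (hf : ∀ i, number (f i) = o + i)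
      (h1 : o ≤ n) (h2 : n < o + k) : ∃ u : PatternVertex s m, number u = n :=
    ⟨f ⟨n - o, by omega⟩, by rw [hf]; simp only; omega⟩
  by_cases h0 : n = 0
  · exact ⟨.y, h0.symm⟩
  by_cases h1 : n = 1
  · exact ⟨.z, h1.symm⟩
  by_cases h2 : n = 2
  · exact ⟨.q, h2.symm⟩
  by_cases h3 : n < 4 * s + 2
  · exact block 3 .p (fun _ => rfl) (by omega) (by omega)
  by_cases h4 : n < 7 * s + 2
  · exact block (4 * s + 2) .v (fun _ => rfl) (by omega) (by omega)
  by_cases h5 : n < 10 * s + 2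
  · exact block (7 * s + 2) .x (fun _ => rfl) (by omega) (by omega)
  by_cases h6 : n < 13 * s + 2
  · exact block (10 * s + 2) .b (fun _ => rfl) (by omega) (by omega)
  by_cases h7 : n < 16 * s + 2
  · exact block (13 * s + 2) .r (fun _ => rfl) (by omega) (by omega)
  by_cases h8 : n < 19 * s + 2
  · exact block (16 * s + 2) .g (fun _ => rfl) (by omega) (by omega)
  by_cases h9 : n < 25 * s + 2
  · exact block (19 * s + 2) .t (fun _ => rfl) (by omega) (by omega)
  by_cases h10 : n < 25 * s + 2 + 3 * s * 2 ^ s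
  · refine ⟨.a ⟨(n - (25 * s + 2)) / 2 ^ s, ?_⟩ ⟨(n - (25 * s + 2)) % 2 ^ s, ?_⟩, ?_⟩
    · exact Nat.div_lt_of_lt_mul (by rw [mul_comm (2 ^ s)]; omega)
    · exact Nat.mod_lt _ (by positivity)
    · simp only [number, assignmentVertex, mul_comm _ (2 ^ s), Nat.div_add_mod]
      omega
  · unfold graphOrder at hn
    exact block (25 * s + 2 + 3 * s * 2 ^ s) .c (fun _ => rfl) (by omega) (by omega)

/-- The vertices are numbered by `0, …, N - 1`. -/
noncomputable def numbering (hs : 0 < s) : PatternVertex s m ≃ Fin (graphOrder s m) :=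
  .ofBijective (fun u => ⟨number u, number_lt hs u⟩)
    ⟨fun _ _ h => number_injective hs (congrArg Fin.val h), fun n =>
      let ⟨u, hu⟩ := exists_number_eq n.1 n.2
      ⟨u, Fin.ext hu⟩⟩

theorem number_numbering_symm (hs : 0 < s) (i : Fin (graphOrder s m)) :
    number ((numbering hs).symm i) = i :=
  congrArg Fin.val ((numbering hs).apply_symm_apply i)

/-! ### The edges in terms of the numbering -/

variable {cl : List (List (ℕ × ℕ × ℕ))} {x : ℕ × ℕ}

theorem mem_links_of_edge {u v : PatternVertex s cl.length} (h : (pattern s cl).Edge u v)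
    (hx : x ∈ link (number u) (number v)) : x ∈ frameLinks s ∪ clauseLinks s cl := by
  have block (b : Fin (3 * s)) (hb : x ∈ blockLinks s b) : x ∈ frameLinks s ∪ clauseLinks s cl :=
    .inl (.inr (.inr (.inr (.inr ⟨b, b.2, hb⟩))))
  have assignment (b : Fin (3 * s)) (f : Fin (2 ^ s)) (hf : x ∈ assignmentLinks s b f) :
      x ∈ frameLinks s ∪ clauseLinks s cl :=
    block b (.inr (.inr (.inr (.inr (.inr ⟨f, f.2, hf⟩)))))
  cases h with
  | yq => exact .inl (.inl hx)
  | yv b => exact .inl (.inr (.inl ⟨b, b.2, hx⟩))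
  | yt j => exact .inl (.inr (.inr (.inl ⟨j, j.2, hx⟩)))
  | zp i => exact .inl (.inr (.inr (.inr (.inl ⟨i, i.2, hx⟩))))
  | za b f => exact assignment b f (.inl hx)
  | vv b b' hne =>
    exact block b (.inr (.inr (.inr (.inr (.inl ⟨b', b'.2, fun h => hne (Fin.ext h), hx⟩)))))
  | vx b => exact block b (.inl hx)
  | vb b => exact block b (.inr (.inl hx))
  | vg b => exact block b (.inr (.inr (.inl hx)))
  | rg b => exact block b (.inr (.inr (.inr (.inl hx))))
  | ra b f => exact assignment b f (.inr (.inl hx))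
  | ax b b' f hne =>
    exact assignment b f (.inr (.inr (.inl ⟨b', b'.2, fun h => hne (Fin.ext h), hx⟩)))
  | aj b f j h =>
    obtain ⟨i, hi, hj⟩ := h
    refine assignment b f (.inr (.inr (.inr ⟨i, hi, ?_⟩)))
    simp only [number, hj] at hx
    exact hx
  | cv C b h =>
    obtain ⟨l, hl, hb⟩ := h
    refine .inr ⟨C, C.2, l, hl, .inl ?_⟩
    simpa only [number, hb] using hx
  | ct C j h =>
    obtain ⟨l, hl, hj⟩ := h
    refine .inr ⟨C, C.2, l, hl, .inr ?_⟩
    simp only [number, hj] at hx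
    exact hx

/-- The bounds on literals ensure that the computed block and value indices stay in range and do not
run into the numbers of another kind of vertex. -/
theorem exists_edge_of_mem_links (hcl : ∀ C ∈ cl, ∀ l ∈ C, IsLit s l)
    (hx : x ∈ frameLinks s ∪ clauseLinks s cl) :
    ∃ u v : PatternVertex s cl.length, (pattern s cl).Edge u v ∧
      x ∈ link (number u) (number v) := by
  rcases hx with (hx | ⟨i, hi, hx⟩ | ⟨i, hi, hx⟩ | ⟨i, hi, hx⟩ | ⟨i, hi, hx⟩) | ⟨c, hc, l, hl, hx⟩
  · exact ⟨.y, .q, .yq, hx⟩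
  · exact ⟨.y, .v ⟨i, hi⟩, .yv _, hx⟩
  · exact ⟨.y, .t ⟨i, hi⟩, .yt _, hx⟩
  · exact ⟨.z, .p ⟨i, hi⟩, .zp _, hx⟩
  · rcases hx with hx | hx | hx | hx | ⟨j, hj, hne, hx⟩ | ⟨f, hf, hx⟩
    · exact ⟨.v ⟨i, hi⟩, .x ⟨i, hi⟩, .vx _, hx⟩
    · exact ⟨.v ⟨i, hi⟩, .b ⟨i, hi⟩, .vb _, hx⟩
    · exact ⟨.v ⟨i, hi⟩, .g ⟨i, hi⟩, .vg _, hx⟩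
    · exact ⟨.r ⟨i, hi⟩, .g ⟨i, hi⟩, .rg _, hx⟩
    · exact ⟨.v ⟨i, hi⟩, .v ⟨j, hj⟩, .vv _ _ (by simpa using hne), hx⟩
    · rcases hx with hx | hx | ⟨j, hj, hne, hx⟩ | ⟨j, hj, hx⟩
      · exact ⟨.z, .a ⟨i, hi⟩ ⟨f, hf⟩, .za _ _, hx⟩
      · exact ⟨.r ⟨i, hi⟩, .a ⟨i, hi⟩ ⟨f, hf⟩, .ra _ _, hx⟩
      · exact ⟨.a ⟨i, hi⟩ ⟨f, hf⟩, .x ⟨j, hj⟩, .ax _ _ _ (by simpa using hne), hx⟩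
      · have h := valueVertex_lt (s := s) (Nat.div_lt_of_lt_mul (by linarith : i < s * 3)) hj
          (Nat.mod_lt (f / 2 ^ j) two_pos)
        refine ⟨.a ⟨i, hi⟩ ⟨f, hf⟩, .t ⟨i / s * (2 * s) + (j + j + f / 2 ^ j % 2), ?_⟩,
          .aj _ _ _ ⟨j, hj, rfl⟩, hx⟩
        unfold valueVertex at h
        omega
  · have hC : cl.getD c [] ∈ cl := by
      rw [List.getD_eq_getElem _ _ hc]; exact List.getElem_mem hc
    obtain ⟨h1, h2, h3⟩ := hcl _ hC l hl
    have hs : 0 < s := Nat.pos_of_ne_zero (by rintro rfl; simp at h2)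
    rcases hx with hx | hx
    · exact ⟨.c ⟨c, hc⟩, .v ⟨l.1 * s + l.2.1 / s, index_lt h1 (Nat.div_lt_of_lt_mul h2)⟩,
        .cv _ _ ⟨l, hl, rfl⟩, hx⟩
    · have h := valueVertex_lt (s := s) h1 (Nat.mod_lt l.2.1 hs) h3
      refine ⟨.c ⟨c, hc⟩, .t ⟨l.1 * (2 * s) + (l.2.1 % s + l.2.1 % s + l.2.2), ?_⟩,
        .ct _ _ ⟨l, hl, rfl⟩, hx⟩
      unfold valueVertex at h
      omega

theorem adj_iff_mem_links (hs : 0 < s) (hcl : ∀ C ∈ cl, ∀ l ∈ C, IsLit s l)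
    {u v : PatternVertex s cl.length} : ((pattern s cl).graph (Fin (4 * s - 1))).Adj u v ↔
      (number u, number v) ∈ frameLinks s ∪ clauseLinks s cl := by
  constructor
  · rintro (h | h)
    · exact mem_links_of_edge h (.inl rfl)
    · exact mem_links_of_edge h (.inr rfl)
  · intro h
    obtain ⟨u', v', he, hx⟩ := exists_edge_of_mem_links hcl h
    rcases hx with hx | hx <;> simp only [Set.mem_singleton_iff, Prod.mk.injEq] at hx <;>
      obtain ⟨h1, h2⟩ := hx <;> obtain rfl := number_injective hs h1 <;>
      obtain rfl := number_injective hs h2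
    · exact .inl he
    · exact .inr he

end RAM

/-! ### Transport along isomorphisms -/

namespace SimpleGraph

variable {V W : Type*} {G : SimpleGraph V} {H : SimpleGraph W}

theorem Steps.map (φ : G ≃g H) {k : ℕ} {u v : V} (h : G.Steps k u v) : H.Steps k (φ u) (φ v) :=
  let ⟨p, hp⟩ := h
  ⟨p.map φ.toHom, by simpa using hp⟩

theorem OnShortestPath.map (φ : G ≃g H) {s t u : V} (h : G.OnShortestPath s t u) :
    H.OnShortestPath (φ s) (φ t) (φ u) := by
  obtain ⟨k, l, h1, h2, h3⟩ := onShortestPath_iff.1 h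
  refine onShortestPath_iff.2 ⟨k, l, h1.map φ, h2.map φ, fun j hj => h3 j ?_⟩
  simpa using hj.map φ.symm

theorem IsGeodeticSet.image (φ : G ≃g H) {S : Set V} (hS : G.IsGeodeticSet S) :
    H.IsGeodeticSet (φ '' S) := by
  intro u
  obtain ⟨s, hs, t, ht, h⟩ := hS (φ.symm u)
  refine ⟨_, ⟨s, hs, rfl⟩, _, ⟨t, ht, rfl⟩, ?_⟩
  simpa using h.map φ

theorem exists_isGeodeticSet_of_iso (φ : G ≃g H) {k : ℕ}
    (h : ∃ S : Finset V, S.card ≤ k ∧ G.IsGeodeticSet (S : Set V)) :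
    ∃ S : Finset W, S.card ≤ k ∧ H.IsGeodeticSet (S : Set W) := by
  obtain ⟨S, hS, h⟩ := h
  refine ⟨S.map φ.toEquiv.toEmbedding, by simpa, ?_⟩
  simpa using h.image φ

end SimpleGraph

namespace RAM

/-! ### Satisfying assignments -/

/-- The clauses of an instance as lists of triples. -/
def clauseTriples (ψ : Partitioned3SAT) : List (List (ℕ × ℕ × ℕ)) :=
  ψ.clauses.map fun C => C.map fun l => ((l.part : ℕ), (l.idx : ℕ), if l.sign then 1 else 0)

theorem encode_eq (ψ : Partitioned3SAT) :
    ψ.encode = ψ.n :: (clauseTriples ψ).length :: clauseWord (clauseTriples ψ) := by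
  simp [Partitioned3SAT.encode, clauseTriples, clauseWord, litWord, List.flatMap_map]

theorem exists_bits (s : ℕ) (g : ℕ → Bool) :
    ∃ x < 2 ^ s, ∀ j < s, x / 2 ^ j % 2 = if g j then 1 else 0 := by
  refine ⟨Nat.ofBits fun i : Fin s => g i, Nat.ofBits_lt_two_pow _, fun j hj => ?_⟩
  have h := Nat.testBit_ofBits_lt (fun i : Fin s => g i) j hj
  rw [Nat.testBit_eq_decide_div_mod_eq] at h
  simp only at h
  rw [← h]
  simp only [decide_eq_true_eq]
  split_ifs <;> omega

theorem isLit_of_mem {ψ : Partitioned3SAT} {s : ℕ} (hn : ψ.n ≤ s * s) :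
    ∀ C ∈ clauseTriples ψ, ∀ l ∈ C, IsLit s l := by
  intro C hC l hl
  obtain ⟨D, -, rfl⟩ := List.mem_map.1 hC
  obtain ⟨l, -, rfl⟩ := List.mem_map.1 hl
  refine ⟨l.part.2, l.idx.2.trans_le hn, ?_⟩
  simp only
  split_ifs <;> norm_num

theorem satisfiable_iff (ψ : Partitioned3SAT) {s : ℕ} (hn : ψ.n ≤ s * s) :
    ψ.Satisfiable ↔ (pattern s (clauseTriples ψ)).Satisfiable := by
  have hclause (C : Fin (clauseTriples ψ).length) : ∃ D ∈ ψ.clauses, (clauseTriples ψ).getD C [] =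
      D.map fun l => ((l.part : ℕ), (l.idx : ℕ), if l.sign then 1 else 0) := by
    have hC : (clauseTriples ψ)[C] ∈ clauseTriples ψ := List.getElem_mem _
    obtain ⟨D, hD, h⟩ := List.mem_map.1 hC
    exact ⟨D, hD, by rw [List.getD_eq_getElem _ _ C.2]; exact h.symm⟩
  have hspos {i : Fin ψ.n} : 0 < s := by
    have := i.2
    exact Nat.pos_of_ne_zero (by rintro rfl; omega)
  have hdiv (i : Fin ψ.n) : i / s < s := Nat.div_lt_of_lt_mul (i.2.trans_le hn)
  constructor
  · rintro ⟨τ, hτ⟩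
    -- The blocks of a part have s² ≥ n positions; the surplus ones are filled with false.
    let τ' (δ i : ℕ) : Bool := if h : δ < 3 ∧ i < ψ.n then τ ⟨δ, h.1⟩ ⟨i, h.2⟩ else false
    choose F hF hFbit using fun b : Fin (3 * s) =>
      exists_bits s fun j => τ' (b / s) ((b % s) * s + j)
    refine ⟨fun b => ⟨F b, hF b⟩, fun C => ?_⟩
    obtain ⟨D, hD, hCD⟩ := hclause C
    obtain ⟨l, hl, hsat⟩ := hτ D hD
    have hs : 0 < s := hspos (i := l.idx)
    have hmod := Nat.mod_lt (l.idx : ℕ) hs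
    have hmem := List.mem_map_of_mem
      (f := fun l : PartLiteral ψ.n => ((l.part : ℕ), (l.idx : ℕ), if l.sign then 1 else 0)) hl
    have hbit : (if l.sign then 1 else 0) < 2 := by split_ifs <;> norm_num
    have hj : (l.part : ℕ) * (2 * s) + (l.idx % s + l.idx % s + if l.sign then 1 else 0) < 6 * s :=
      (index_lt l.part.2 (by omega)).trans_eq (by ring)
    refine ⟨⟨l.part * s + l.idx / s, index_lt l.part.2 (hdiv _)⟩, ⟨_, hCD ▸ hmem, rfl⟩, ⟨_, hj⟩,
      ⟨_, hCD ▸ hmem, rfl⟩, l.idx % s, hmod, ?_⟩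
    have h1 : ((l.part : ℕ) * s + l.idx / s) / s = l.part := by
      rw [mul_comm, Nat.mul_add_div hs, Nat.div_eq_of_lt (hdiv _), add_zero]
    have h2 : ((l.part : ℕ) * s + l.idx / s) % s = l.idx / s := by
      rw [mul_comm, Nat.mul_add_mod, Nat.mod_eq_of_lt (hdiv _)]
    have h3 : (l.idx : ℕ) / s * s + l.idx % s = l.idx := by
      rw [mul_comm, Nat.div_add_mod]
    simp only [hFbit _ _ hmod, h1, h2, h3]
    simp only [τ', l.part.2, l.idx.2, and_self, dite_true, Fin.eta, hsat]
  · rintro ⟨f, hf⟩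
    refine ⟨fun δ i => decide (
      (f ⟨δ * s + i / s, index_lt δ.2 (hdiv i)⟩ : ℕ) / 2 ^ ((i : ℕ) % s) % 2
      = 1), fun D hD => ?_⟩
    obtain ⟨c, hc, rfl⟩ := List.getElem_of_mem hD
    have hc' : c < (clauseTriples ψ).length := by simpa [clauseTriples] using hc
    obtain ⟨b, ⟨x, hx, hb⟩, j, ⟨x', hx', hj⟩, i, hi, hij⟩ := hf ⟨c, hc'⟩
    have hcD : (clauseTriples ψ).getD c [] =
        ψ.clauses[c].map fun l => ((l.part : ℕ), (l.idx : ℕ), if l.sign then 1 else 0) := by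
      rw [List.getD_eq_getElem _ _ hc']; simp [clauseTriples]
    simp only [hcD] at hx hx'
    obtain ⟨l, hl, rfl⟩ := List.mem_map.1 hx
    obtain ⟨l', hl', rfl⟩ := List.mem_map.1 hx'
    simp only at hb hj
    have hs : 0 < s := hspos (i := l.idx)
    have hmod := Nat.mod_lt (l'.idx : ℕ) hs
    have h1 : (b : ℕ) / s = l.part := by
      rw [hb, mul_comm, Nat.mul_add_div hs, Nat.div_eq_of_lt (hdiv _), add_zero]
    have hbit : (if l'.sign then 1 else 0) < 2 := by split_ifs <;> norm_num
    have hbit' := Nat.mod_lt ((f b : ℕ) / 2 ^ i) two_pos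
    rw [hj, h1, mul_add_inj (by omega) (by omega)] at hij
    obtain ⟨hpart, hval⟩ := hij
    -- The block may come from one literal l and the value from another literal l'. The assignment
    -- takes the value, so both have the same part; the clause then has only one variable there, and
    -- the block is that of l'.
    have hidx := ψ.partitioned _ hD l' hl' l hl (Fin.ext hpart)
    obtain rfl : i = l'.idx % s := by omega
    have hb' : b = ⟨l'.part * s + l'.idx / s, index_lt l'.part.2 (hdiv _)⟩ :=
      Fin.ext (by simp only [hb, hidx, hpart])
    refine ⟨l', hl', ?_⟩
    simp only [← hb']
    cases h : l'.sign <;> simp only [h, if_true, Bool.false_eq_true, if_false] at hval <;>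
      simp <;> omega

/-! ### The instance -/

section Instance

variable {s m : ℕ} (hs : 0 < s) (cl : List (List (ℕ × ℕ × ℕ)))

/-- The instance of Geodetic Set for the clauses `cl`. -/
noncomputable def geodeticInstance : GeodeticSetInstance where
  order := graphOrder s cl.length
  graph := ((pattern s cl).graph (Fin (4 * s - 1))).comap (numbering hs).symm
  k := 10 * s
  k_pos := by omega

theorem geodeticInstance_adj (hcl : ∀ C ∈ cl, ∀ l ∈ C, IsLit s l)
    (i j : Fin (graphOrder s cl.length)) : (geodeticInstance hs cl).graph.Adj i j ↔
      ((i : ℕ), (j : ℕ)) ∈ frameLinks s ∪ clauseLinks s cl := by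
  change ((pattern s cl).graph _).Adj _ _ ↔ _
  rw [adj_iff_mem_links hs hcl, number_numbering_symm, number_numbering_symm]

theorem geodeticInstance_encode (hcl : ∀ C ∈ cl, ∀ l ∈ C, IsLit s l) :
    (geodeticInstance hs cl).encode =
      graphWord (10 * s) (graphOrder s cl.length) (frameLinks s ∪ clauseLinks s cl) := by
  classical
  simp only [GeodeticSetInstance.encode, graphWord]
  change 10 * s :: graphOrder s cl.length ::
    (List.finRange (graphOrder s cl.length)).flatMap _ = _
  rw [← List.map_coe_finRange_eq_range, List.flatMap_map]
  congr 3
  funext i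
  rw [List.map_map]
  refine List.map_congr_left fun j _ => ?_
  have h := geodeticInstance_adj hs cl hcl i j
  by_cases hE : ((i : ℕ), (j : ℕ)) ∈ frameLinks s ∪ clauseLinks s cl
  · exact (if_pos (h.2 hE)).trans (if_pos hE).symm
  · exact (if_neg (mt h.1 hE)).trans (if_neg hE).symm

theorem geodeticInstance_isYes_iff :
    (geodeticInstance hs cl).IsYes ↔ (pattern s cl).Satisfiable := by
  have : Nonempty (Fin (4 * s - 1)) := ⟨⟨0, by omega⟩⟩
  have : Nontrivial (Fin (3 * s)) := Fin.nontrivial_iff_two_le.2 (by omega)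
  have : Nonempty (Fin (2 ^ s)) := ⟨⟨0, by positivity⟩⟩
  rw [← ChoicePattern.exists_isGeodeticSet_iff (π := Fin (4 * s - 1))]
  -- The number 4s - 1 of leaves at `z` is padding chosen to make the budget exactly 10s; the
  -- argument itself needs only one such leaf.
  · have hk : 1 + Fintype.card (Fin (4 * s - 1)) + 2 * Fintype.card (Fin (3 * s)) = 10 * s := by
      simp only [Fintype.card_fin]; omega
    rw [hk]
    let φ : (geodeticInstance hs cl).graph ≃g (pattern s cl).graph (Fin (4 * s - 1)) :=
      ⟨(numbering hs).symm, Iff.rfl⟩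
    exact ⟨SimpleGraph.exists_isGeodeticSet_of_iso φ,
      SimpleGraph.exists_isGeodeticSet_of_iso φ.symm⟩
  · intro b f
    have hb : (b : ℕ) / s < 3 := Nat.div_lt_of_lt_mul (by linarith [b.2])
    have hbit := Nat.mod_lt ((f : ℕ) / 2 ^ 0) two_pos
    exact ⟨⟨_, (index_lt hb (by omega)).trans_eq (by ring)⟩, 0, hs, rfl⟩
  · intro j
    have hj : (j : ℕ) / (2 * s) < 3 := Nat.div_lt_of_lt_mul (by linarith [j.2])
    have hmod := Nat.mod_lt (j : ℕ) (by omega : 0 < 2 * s)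
    obtain ⟨x, hx, hbit⟩ := exists_bits s fun _ => decide ((j : ℕ) % (2 * s) % 2 = 1)
    have hi : (j : ℕ) % (2 * s) / 2 < s := by omega
    -- The first block of the part of j, with all its variables set to the parity of the offset of
    -- j.
    refine ⟨⟨j / (2 * s) * s, ?_⟩, ⟨x, hx⟩, j % (2 * s) / 2, hi, ?_⟩
    · simpa using index_lt hj hs
    · simp only [hbit _ hi, Nat.mul_div_cancel _ hs, decide_eq_true_eq]
      have := Nat.div_add_mod (j : ℕ) (2 * s)
      rw [mul_comm] at this
      split_ifs <;> omega

theorem geodeticInstance_vc_le : (geodeticInstance hs cl).vc ≤ 25 * s + 2 := by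
  -- All vertices except those for assignments and clauses; this contains `InCover` and is easier to
  -- count.
  let c : Finset (Fin (graphOrder s cl.length)) := {i | (i : ℕ) < 25 * s + 2}
  have hc : (geodeticInstance hs cl).graph.IsVertexCover
      (c : Set (Fin (graphOrder s cl.length))) := by
    have key (i : Fin (graphOrder s cl.length))
        (h : ChoicePattern.InCover ((numbering (m := cl.length) hs).symm i)) : i ∈ c := by
      have hi := number_numbering_symm hs i
      generalize (numbering hs).symm i = u at h hi
      simp only [c, Finset.mem_filter, Finset.mem_univ, true_and, ← hi]
      cases u <;> first | exact h.elim | simp only [number]; omega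
    intro i j hij
    rcases ChoicePattern.inCover_or_inCover hij with h | h
    · exact .inl (key i h)
    · exact .inr (key j h)
  have hcard : c.card ≤ 25 * s + 2 := by
    rw [← Finset.card_range (25 * s + 2)]
    exact Finset.card_le_card_of_injOn Fin.val (by intro i; simp [c])
      (fun _ _ _ _ h => Fin.ext h)
  refine ENat.toNat_le_of_le_natCast (hc.vertexCoverNum_le.trans ?_)
  exact (Set.encard_coe_eq_coe_finsetCard c).trans_le (by exact_mod_cast hcard)

end Instance

/-! ### The bounds -/

theorem blockSize_eq {n : ℕ} (hn : 0 < n) : blockSize n = ⌈√(n : ℝ)⌉₊ := by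
  apply le_antisymm
  · have h : (n : ℝ) ≤ (⌈√(n : ℝ)⌉₊ * ⌈√(n : ℝ)⌉₊ : ℕ) := by
      have h1 := Nat.le_ceil √(n : ℝ)
      have h2 := Real.sqrt_nonneg (n : ℝ)
      push_cast
      calc (n : ℝ) = √n * √n := (Real.mul_self_sqrt (by positivity)).symm
        _ ≤ _ := by gcongr
    refine blockSize_le (Nat.ceil_pos.2 (Real.sqrt_pos.2 (by exact_mod_cast hn))) ?_
    exact_mod_cast h
  · refine Nat.ceil_le.2 (Real.sqrt_le_iff.2 ⟨by positivity, ?_⟩)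
    rw [pow_two]
    exact_mod_cast le_blockSize_sq n

/-- A clause is determined by its at most three entries, each one of 6n literals or absent. Without
`nodup` the list of clauses could be arbitrarily long. -/
theorem length_clauses_le (ψ : Partitioned3SAT) : ψ.clauses.length ≤ (6 * ψ.n + 1) ^ 3 := by
  classical
  let F (C : List (PartLiteral ψ.n)) (i : Fin 3) : Option (Fin 3 × Fin ψ.n × Bool) :=
    C[(i : ℕ)]?.map fun l => (l.part, l.idx, l.sign)
  have hF : Set.InjOn F ψ.clauses.toFinset := by
    intro C hC D hD h
    rw [Finset.mem_coe, List.mem_toFinset] at hC hD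
    refine List.ext_getElem? fun i => ?_
    by_cases hi : i < 3
    · refine Option.map_injective (f := fun l : PartLiteral ψ.n => (l.part, l.idx, l.sign)) ?_
        (congrFun h ⟨i, hi⟩)
      rintro ⟨a, b, c⟩ ⟨a', b', c'⟩ h
      simpa using h
    · have h1 := ψ.length_le C hC
      have h2 := ψ.length_le D hD
      rw [List.getElem?_eq_none (by omega), List.getElem?_eq_none (by omega)]
  have h := Finset.card_le_card_of_injOn F (t := Finset.univ) (by simp) hF
  rw [List.toFinset_card_of_nodup ψ.nodup, Finset.card_univ] at h
  simp only [Fintype.card_fun, Fintype.card_option, Fintype.card_prod, Fintype.card_fin,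
    Fintype.card_bool] at h
  calc ψ.clauses.length ≤ _ := h
    _ = _ := by ring

theorem graphOrder_le {ψ : Partitioned3SAT} {s : ℕ} (hs : 0 < s) (hn : ψ.n ≤ s * s) :
    graphOrder s ψ.clauses.length ≤ 2 ^ (15 * s) := by
  have hm : ψ.clauses.length ≤ 343 * 2 ^ (6 * s) :=
    calc ψ.clauses.length ≤ (6 * ψ.n + 1) ^ 3 := length_clauses_le ψ
      _ ≤ (7 * (s * s)) ^ 3 := by
        gcongr
        have : 1 ≤ s * s := Nat.mul_pos hs hs
        omega
      _ = 343 * s ^ 6 := by ring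
      _ ≤ 343 * (2 ^ s) ^ 6 := by gcongr; exact Nat.lt_two_pow_self.le
      _ = _ := by rw [← pow_mul, mul_comm s]
  have h1 : s ≤ 2 ^ (6 * s) := Nat.lt_two_pow_self.le.trans
    (Nat.pow_le_pow_right (by norm_num) (by omega))
  have h2 : 1 ≤ 2 ^ (6 * s) := Nat.one_le_two_pow
  have h3 : s * 2 ^ s ≤ 2 ^ (6 * s) :=
    calc s * 2 ^ s ≤ 2 ^ s * 2 ^ s := Nat.mul_le_mul_right _ Nat.lt_two_pow_self.le
      _ = 2 ^ (s + s) := (pow_add _ _ _).symm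
      _ ≤ _ := Nat.pow_le_pow_right (by norm_num) (by omega)
  -- The coefficients add up to 25 + 2 + 3 + 343 = 373 ≤ 2^9.
  calc graphOrder s ψ.clauses.length ≤ 2 ^ 9 * 2 ^ (6 * s) := by
        unfold graphOrder
        rw [mul_assoc 3]
        omega
    _ = 2 ^ (9 + 6 * s) := (pow_add _ _ _).symm
    _ ≤ _ := Nat.pow_le_pow_right (by norm_num) (by omega)

end RAM

/-! ### The main theorem -/

theorem theorem4 :
    ∃ (P : RAM.Com) (c : ℝ), ∀ ψ : Partitioned3SAT,
      ∃ (I : GeodeticSetInstance) (t : ℕ),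
        RAM.RunsTo P ψ.encode t I.encode ∧
        (ψ.Satisfiable ↔ I.IsYes) ∧
        (0 < ψ.n →
          (t : ℝ) ≤ 2 ^ (c * √(ψ.numVars : ℝ)) ∧
          I.k = 10 * ⌈√(ψ.n : ℝ)⌉₊ ∧
          (I.vc : ℝ) + (I.k : ℝ) ≤ c * √(ψ.numVars : ℝ) ∧
          (I.order : ℝ) ≤ 2 ^ (c * √(ψ.numVars : ℝ))) := by
  obtain ⟨K, d, hKd⟩ := RAM.Com.reduction.bound_le_poly
  -- The factor 2 comes from s ≤ 2√N. The time is at most K · (2^(15s))^d ≤ 2^((K+15d)s), and 37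
  -- covers (25s + 2) + 10s ≤ 37s.
  refine ⟨.reduction, 2 * (K + 15 * d + 37), fun ψ => ?_⟩
  obtain ⟨s, hs⟩ : ∃ s, s = RAM.blockSize ψ.n := ⟨_, rfl⟩
  -- This holds for n = 0 as well, where s = 1, so correctness needs no separate case.
  have hpos : 0 < s := by simp [hs, RAM.blockSize]
  have hn : ψ.n ≤ s * s := hs ▸ RAM.le_blockSize_sq _
  have hlit := RAM.isLit_of_mem hn
  have hlen : (RAM.clauseTriples ψ).length = ψ.clauses.length := by simp [RAM.clauseTriples]
  obtain ⟨t, ht, hrun⟩ := RAM.reduction_runsTo (cl := RAM.clauseTriples ψ) hs rfl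
    (by
      intro C hC
      obtain ⟨D, hD, rfl⟩ := List.mem_map.1 hC
      simpa using ψ.length_le D hD) hlit
  refine ⟨RAM.geodeticInstance hpos (RAM.clauseTriples ψ), t, ?_, ?_, fun hn0 => ?_⟩
  · rw [RAM.encode_eq, RAM.geodeticInstance_encode hpos _ hlit]
    exact hrun
  · rw [RAM.satisfiable_iff ψ hn, RAM.geodeticInstance_isYes_iff]
  have horder : RAM.graphOrder s (RAM.clauseTriples ψ).length ≤ 2 ^ (15 * s) := by
    rw [hlen]; exact RAM.graphOrder_le hpos hn
  have hsR : (s : ℝ) ≤ 2 * √(ψ.numVars : ℝ) := by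
    have h1 : (s : ℝ) < √ψ.n + 1 := by
      rw [hs, RAM.blockSize_eq hn0]
      exact Nat.ceil_lt_add_one (Real.sqrt_nonneg _)
    have h2 : (1 : ℝ) ≤ √ψ.n := Real.one_le_sqrt.2 (by exact_mod_cast hn0)
    have h3 : √(ψ.n : ℝ) ≤ √(ψ.numVars : ℝ) := by
      refine Real.sqrt_le_sqrt ?_
      exact_mod_cast (by unfold Partitioned3SAT.numVars; omega : ψ.n ≤ ψ.numVars)
    linarith
  have hpow {x e : ℕ} (hx : x ≤ 2 ^ (e * s)) (he : e ≤ K + 15 * d + 37) :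
      (x : ℝ) ≤ 2 ^ ((2 * (K + 15 * d + 37) : ℝ) * √(ψ.numVars : ℝ)) := by
    calc (x : ℝ) ≤ ((2 ^ (e * s) : ℕ) : ℝ) := by exact_mod_cast hx
      _ = (2 : ℝ) ^ ((e * s : ℕ) : ℝ) := by rw [Real.rpow_natCast]; push_cast; rfl
      _ ≤ _ := by
        refine Real.rpow_le_rpow_of_exponent_le (by norm_num) ?_
        have he' : (e : ℝ) ≤ K + 15 * d + 37 := by exact_mod_cast he
        push_cast
        calc (e : ℝ) * s ≤ (K + 15 * d + 37) * (2 * √(ψ.numVars : ℝ)) :=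
              mul_le_mul he' hsR (by positivity) (by positivity)
          _ = _ := by ring
  refine ⟨hpow (e := K + 15 * d) ?_ (by omega), ?_, ?_, hpow (e := 15) horder (by omega)⟩
  · calc t ≤ K * RAM.graphOrder s (RAM.clauseTriples ψ).length ^ d := ht.trans (hKd _ (by
          have := RAM.le_graphOrder s (RAM.clauseTriples ψ).length
          omega))
      _ ≤ 2 ^ (K * s) * (2 ^ (15 * s)) ^ d := by
        gcongr
        exact Nat.lt_two_pow_self.le.trans
          (Nat.pow_le_pow_right (by norm_num) (Nat.le_mul_of_pos_right _ hpos))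
      _ = 2 ^ ((K + 15 * d) * s) := by rw [← pow_mul, ← pow_add]; congr 1; ring
  · change 10 * s = _
    rw [hs, RAM.blockSize_eq hn0]
  · have hvc : ((RAM.geodeticInstance hpos (RAM.clauseTriples ψ)).vc : ℝ) ≤ 25 * s + 2 := by
      exact_mod_cast RAM.geodeticInstance_vc_le hpos (RAM.clauseTriples ψ)
    have hk : ((RAM.geodeticInstance hpos (RAM.clauseTriples ψ)).k : ℝ) = 10 * s := by
      change ((10 * s : ℕ) : ℝ) = _
      push_cast; rfl
    have hs1 : (1 : ℝ) ≤ s := by exact_mod_cast hpos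
    have hq : 0 ≤ √(ψ.numVars : ℝ) := Real.sqrt_nonneg _
    have hK : 0 ≤ (K : ℝ) * √(ψ.numVars : ℝ) := by positivity
    have hd : 0 ≤ (d : ℝ) * √(ψ.numVars : ℝ) := by positivity
    rw [hk]
    linarith
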